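/- **Notation.** For $d\ge 2$, tensors $T\in\mathbb{R}^{N^d}$ (order $d$, all sizes $N$) have entries $T_\omega$, $\omega\in[N]^d$; $\|T\|_\infty=\max_\omega|T_\omega|$, and $\operatorname{rank}(T)$ is the CP rank, the least number of rank-one tensors with sum $T$. The max-qnorm is $\|T\|_{\max}=\inf\prod_{j=1}^d\|U^{(j)}\|_{2,\infty}$ over all factorizations $T(i_1,\dots,i_d)=\sum_{l=1}^k\prod_{j}U^{(j)}(i_j,l)$ with any $k$, where $\|U\|_{2,\infty}$ is the maximum Euclidean row norm. The M-norm is $\|T\|_M=\inf\{t>0: T\in t\,\mathrm{conv}(T_\pm)\}$, where $T_\pm$ is the set of rank-one tensors with all entries in $\{\pm1\}$. Let $K_{\max}(\alpha,R)=\{X:\|X\|_\infty\le\alpha,\ \|X\|_{\max}\le R\}$ and $K_M(\alpha,R)=\{X:\|X\|_\infty\le\alpha,\ \|X\|_M\le R\}$. **Model.** Let $f:\mathbb{R}\to[0,1]$ be nondecreasing and differentiable, with $f$ and $f'$ nonvanishing on $[-\alpha,\alpha]$ and with $$L_\alpha=\sup_{|x|\le\alpha}\frac{|f'(x)|}{f(x)(1-f(x))},\qquad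 \beta_\alpha=\sup_{|x|\le\alpha}\frac{f(x)(1-f(x))}{f'(x)^2},\qquad U_\alpha=\sup_{|x|\le\alpha}\log\frac{1}{f(x)(1-f(x))}$$ finite. Let $\Pi=(\pi_\omega)$ be a probability distribution on $[N]^d$. We observe $m$ independent pairs $(\omega_t,Y_t)$, where $\omega_t\sim\Pi$ and, given $\omega_t$, $Y_t=+1$ with probability $f(T_{\omega_t})$ and $Y_t=-1$ with probability $1-f(T_{\omega_t})$. The negative log-likelihood is $$\mathcal{L}(X)=\sum_{t=1}^m\Big(\mathbf{1}_{[Y_t=1]}\log\tfrac{1}{f(X_{\omega_t})}+\mathbf{1}_{[Y_t=-1]}\log\tfrac{1}{1-f(X_{\omega_t})}\Big).$$ **Statement.** Put $R_{\max}=\sqrt{r^{d^2-2}}\,\alpha$ and $R_M=(r\sqrt r)^{d-1}\alpha$. (1) If $d\ge2$, $T\in\mathbb{R}^{N^d}$ has rank at most $r$ and $\|T\|_\infty\le\alpha$, then $\|T\|_{\max}\le R_{\max}$ and $\|T\|_M\le R_M$. (2) There are absolute constants $C_{\max},C_M>0$ and $0<c_2<\sqrt2$ such that the following holds for all $d\ge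 2$, all $N$, $r$, $\alpha$, $f$, $\Pi$ as above, all $2\le m\le N^d$ and all $T\in\mathbb{R}^{N^d}$ of rank at most $r$ with $\|T\|_\infty\le\alpha$. For every realization of the sample, $\mathcal{L}$ has a minimizer on $K_{\max}(\alpha,R_{\max})$ and a minimizer on $K_M(\alpha,R_M)$. For every $\delta>0$, with probability greater than $1-\delta$, every minimizer $\hat T_{\max}$ of $\mathcal{L}$ on $K_{\max}(\alpha,R_{\max})$ satisfies $$\sum_\omega\pi_\omega\big(\hat T_{\max}(\omega)-T(\omega)\big)^2\le C_{\max}\,c_2^d\,\beta_\alpha\Big\{L_\alpha R_{\max}\sqrt{\tfrac{dN}{m}}+U_\alpha\sqrt{\tfrac{\log(4/\delta)}{m}}\Big\};$$ and for every $\delta>0$, with probability greater than $1-\delta$, every minimizer $\hat T_M$ of $\mathcal{L}$ on $K_M(\alpha,R_M)$ satisfies $$\sum_\omega\pi_\omega\big(\hat T_M(\omega)-T(\omega)\big)^2\le C_M\,\beta_\alpha\Big\{L_\alpha R_M\sqrt{\tfrac{dN}{m}}+U_\alpha\sqrt{\tfrac{\log(4/\delta)}{m}}\Big\}.$$ (For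 $\delta>4$ the square root of the negative number is read as $0$; for $\delta>1$ the claim is trivial.) -/

import Mathlib

open MeasureTheory
open scoped Pointwise

noncomputable section

namespace OneBitTensor

/-- Indices `ω = (i₁, …, i_d)` of an order-`d` tensor of size `N × ⋯ × N`. -/
abbrev Idx (d N : ℕ) : Type := Fin d → Fin N

/-- Real order-`d` tensors of size `N × ⋯ × N`, given by their entries. The norm `‖T‖` that this
type carries is the infinity norm, the largest absolute value of an entry. -/
abbrev Tensor (d N : ℕ) : Type := Idx d N → ℝ

/-- The outer product `U⁽¹⁾ ∘ ⋯ ∘ U⁽ᵈ⁾` of `N × k` factor matrices. -/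
def outer {d N k : ℕ} (U : Fin d → Matrix (Fin N) (Fin k) ℝ) : Tensor d N :=
  fun ω => ∑ l : Fin k, ∏ j : Fin d, U j (ω j) l

/-- The CP rank: the least `r` such that `T = ∑_{i ≤ r} λᵢ Uᵢ` with unit tensors `Uᵢ`, that is,
outer products of `d` vectors of Euclidean norm one. -/
def rank {d N : ℕ} (T : Tensor d N) : ℕ :=
  sInf {r : ℕ | ∃ (c : Fin r → ℝ) (u : Fin r → Fin d → EuclideanSpace ℝ (Fin N)),
    (∀ i j, ‖u i j‖ = 1) ∧ ∀ ω, T ω = ∑ i : Fin r, c i * ∏ j : Fin d, u i j (ω j)}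

/-- `‖U‖_{2,∞}`, the maximum Euclidean norm of a row. -/
def rowNorm {N k : ℕ} (U : Matrix (Fin N) (Fin k) ℝ) : ℝ :=
  ⨆ i : Fin N, √(∑ l : Fin k, U i l ^ 2)

/-- The max-qnorm: the infimum of `∏ⱼ ‖U⁽ʲ⁾‖_{2,∞}` over all factorizations
`T = U⁽¹⁾ ∘ ⋯ ∘ U⁽ᵈ⁾`, with any number `k` of columns. -/
def maxQNorm {d N : ℕ} (T : Tensor d N) : ℝ :=
  sInf {x : ℝ | ∃ (k : ℕ) (U : Fin d → Matrix (Fin N) (Fin k) ℝ),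
    T = outer U ∧ x = ∏ j : Fin d, rowNorm (U j)}

/-- The set `T_±` of rank-one tensors all of whose entries are `1` or `-1`. -/
def signTensors (d N : ℕ) : Set (Tensor d N) :=
  {T | (∀ ω, T ω = 1 ∨ T ω = -1) ∧ rank T = 1}

/-- The atomic M-norm: the gauge of the convex hull of `T_±`. -/
def mNorm {d N : ℕ} (T : Tensor d N) : ℝ :=
  sInf {t : ℝ | 0 < t ∧ T ∈ t • convexHull ℝ (signTensors d N)}

/-- The constraint set of the max-qnorm constrained estimator. -/
def KMax (d N : ℕ) (α R : ℝ) : Set (Tensor d N) := {T | ‖T‖ ≤ α ∧ maxQNorm T ≤ R}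

/-- The constraint set of the M-norm constrained estimator. -/
def KM (d N : ℕ) (α R : ℝ) : Set (Tensor d N) := {T | ‖T‖ ≤ α ∧ mNorm T ≤ R}

/-- The quantity whose supremum over `[-α, α]` is the steepness `L_α`. -/
def steepness (f : ℝ → ℝ) (x : ℝ) : ℝ := |deriv f x| / (f x * (1 - f x))

/-- The quantity whose supremum over `[-α, α]` is the flatness `β_α`. -/
def flatness (f : ℝ → ℝ) (x : ℝ) : ℝ := f x * (1 - f x) / deriv f x ^ 2

/-- The quantity whose supremum over `[-α, α]` is `U_α`. -/
def logRange (f : ℝ → ℝ) (x : ℝ) : ℝ := Real.log (1 / (f x * (1 - f x)))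

/-- The constant `L_α`. -/
def Lconst (f : ℝ → ℝ) (α : ℝ) : ℝ := sSup (steepness f '' Set.Icc (-α) α)

/-- The constant `β_α`. -/
def βconst (f : ℝ → ℝ) (α : ℝ) : ℝ := sSup (flatness f '' Set.Icc (-α) α)

/-- The constant `U_α`. -/
def Uconst (f : ℝ → ℝ) (α : ℝ) : ℝ := sSup (logRange f '' Set.Icc (-α) α)

/-- The standing assumptions on the link function `f : ℝ → [0, 1]`: it is monotone and
differentiable, `f` and its derivative do not vanish on `[-α, α]`, and the suprema `L_α`, `β_α`,
`U_α` are finite. -/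
structure IsLink (f : ℝ → ℝ) (α : ℝ) : Prop where
  mem_Icc : ∀ x, f x ∈ Set.Icc (0 : ℝ) 1
  monotone : Monotone f
  differentiable : Differentiable ℝ f
  ne_zero : ∀ x ∈ Set.Icc (-α) α, f x ≠ 0
  deriv_ne_zero : ∀ x ∈ Set.Icc (-α) α, deriv f x ≠ 0
  bdd_L : BddAbove (steepness f '' Set.Icc (-α) α)
  bdd_β : BddAbove (flatness f '' Set.Icc (-α) α)
  bdd_U : BddAbove (logRange f '' Set.Icc (-α) α)

/-- The law of one measurement `(ω, Y)`: the index `ω` has law `p`, and given `ω` the label is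
`+1` (coded by `true`) with probability `f (T ω)` and `-1` (coded by `false`) with probability
`1 - f (T ω)`. -/
def measurementLaw {d N : ℕ} (f : ℝ → ℝ) (p : Idx d N → ℝ) (T : Tensor d N) :
    Measure (Idx d N × Bool) :=
  ∑ ω : Idx d N, ENNReal.ofReal (p ω) •
    (ENNReal.ofReal (f (T ω)) • Measure.dirac (ω, true) +
      ENNReal.ofReal (1 - f (T ω)) • Measure.dirac (ω, false))

/-- The law of `m` independent measurements. -/
def sampleLaw {d N : ℕ} (m : ℕ) (f : ℝ → ℝ) (p : Idx d N → ℝ) (T : Tensor d N) :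
    Measure (Fin m → Idx d N × Bool) :=
  Measure.pi fun _ => measurementLaw f p T

/-- The negative log-likelihood of `X` given the sample `s`. -/
def negLogLik {d N m : ℕ} (f : ℝ → ℝ) (s : Fin m → Idx d N × Bool) (X : Tensor d N) : ℝ :=
  ∑ t : Fin m, if (s t).2 = true then Real.log (1 / f (X (s t).1))
    else Real.log (1 / (1 - f (X (s t).1)))

/-- `That` minimizes the negative log-likelihood over the constraint set `K`. -/
def IsEstimator {d N m : ℕ} (f : ℝ → ℝ) (s : Fin m → Idx d N × Bool) (K : Set (Tensor d N))
    (That : Tensor d N) : Prop :=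
  That ∈ K ∧ ∀ X ∈ K, negLogLik f s That ≤ negLogLik f s X

/-- The squared error weighted by the sampling distribution `p`. -/
def weightedSqError {d N : ℕ} (p : Idx d N → ℝ) (T X : Tensor d N) : ℝ :=
  ∑ ω : Idx d N, p ω * (X ω - T ω) ^ 2

/-- The radius `√(r^{d²-2}) α` of the max-qnorm constraint. -/
def radiusMax (d r : ℕ) (α : ℝ) : ℝ := √((r : ℝ) ^ (d ^ 2 - 2)) * α

/-- The radius `(r√r)^{d-1} α` of the M-norm constraint. -/
def radiusM (d r : ℕ) (α : ℝ) : ℝ := ((r : ℝ) * √(r : ℝ)) ^ (d - 1) * α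

/-- The expression `β_α (L_α R √(dN/m) + U_α √(log(4/δ)/m))`. -/
def errorRate (d N m : ℕ) (f : ℝ → ℝ) (α R δ : ℝ) : ℝ :=
  βconst f α * (Lconst f α * R * √((d : ℝ) * N / m) + Uconst f α * √(Real.log (4 / δ) / m))

end OneBitTensor

end

noncomputable section

namespace OneBitTensor

/-! Norm bounds. The rows of the first factor matrix are vectors in `ℝ^r`, and the subfamily of
largest determinant expresses all of them with coefficients in `[-1, 1]` (`exists_bounded_coeff`).
So every slice of `T` is a bounded combination of `r` slices of `T`, which still have entries at
most `α`. Recursing over the modes writes `T` as `α` times a sum of `r ^ (d - 1)` rank-one tensors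
with entries in `[-1, 1]` (`exists_bounded_decomposition`). Each of these lies in the hull of the
sign tensors, which bounds the M-norm. Used as columns of a factorization, they bound the max-qnorm.

Estimation error. The mean excess loss of `X` over `T` is a Kullback-Leibler divergence. It
dominates a squared Hellinger distance, hence the weighted squared error divided by `8 β`
(`IsLink.sq_sub_le_kl`). A minimizer has nonpositive empirical excess loss, so its mean excess loss
is at most a uniform deviation over `K`. McDiarmid's inequality, symmetrization, contraction (the
loss is `L`-Lipschitz) and Massart's lemma bound this deviation, once every linear functional on `K`
is dominated by `B` times its maximum over a finite class of bounded tensors (`uniform_deviation`,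
`estimator_error`).

Finite classes. For the M-norm ball the class consists of the `2 ^ (d N)` products of sign vectors,
with `B = R`. For the max-qnorm ball a multilinear Grothendieck inequality is needed, and each mode
beyond the second costs a Khinchine constant. Random quaternion units have fourth-moment constant
`3/2`, where real signs have `3`, so the cost per mode is `√(3/2)`, times `10/9` for passing to a
finite net of quaternions (`multilinear_grothendieck`). The product is below `√2`. The resulting
class has `|t| ^ (d N)` elements with `t` a fixed finite set, so the entropy is again of order `d
N`.

Minimizers exist because both constraint sets are compact. -/

/-- The expectation of `F` over `m` independent draws from the weights `w`. -/
def prodExp {S : Type*} [Fintype S] (w : S → ℝ) {m : ℕ} (F : (Fin m → S) → ℝ) : ℝ :=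
  ∑ s, (∏ t, w (s t)) * F s

/-! ### Product expectations and McDiarmid's inequality -/

section prodExp

variable {S : Type*} [Fintype S] {w : S → ℝ} {m : ℕ}

lemma prodExp_zero (F : (Fin 0 → S) → ℝ) : prodExp w F = F default := by
  simp [prodExp]

lemma sum_fin_succ_fun {M : Type*} [AddCommMonoid M] (F : (Fin (m + 1) → S) → M) :
    ∑ s, F s = ∑ a, ∑ s : Fin m → S, F (Fin.cons a s) := by
  rw [← Fintype.sum_prod_type']
  exact (Fintype.sum_equiv (Fin.consEquiv fun _ => S) _ _ fun _ => rfl).symm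

lemma prodExp_succ (F : (Fin (m + 1) → S) → ℝ) :
    prodExp w F = ∑ a, w a * prodExp w fun s => F (Fin.cons a s) := by
  simp only [prodExp, sum_fin_succ_fun, Finset.mul_sum, Fin.prod_univ_succ, Fin.cons_zero,
    Fin.cons_succ, mul_assoc]

lemma prodExp_mono (hw : ∀ a, 0 ≤ w a) {F G : (Fin m → S) → ℝ} (h : ∀ s, F s ≤ G s) :
    prodExp w F ≤ prodExp w G :=
  Finset.sum_le_sum fun s _ =>
    mul_le_mul_of_nonneg_left (h s) (Finset.prod_nonneg fun _ _ => hw _)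

lemma prodExp_add (F G : (Fin m → S) → ℝ) :
    prodExp w (fun s => F s + G s) = prodExp w F + prodExp w G := by
  simp [prodExp, mul_add, Finset.sum_add_distrib]

lemma prodExp_sub (F G : (Fin m → S) → ℝ) :
    prodExp w (fun s => F s - G s) = prodExp w F - prodExp w G := by
  simp [prodExp, mul_sub, Finset.sum_sub_distrib]

lemma prodExp_const_mul (c : ℝ) (F : (Fin m → S) → ℝ) :
    prodExp w (fun s => c * F s) = c * prodExp w F := by
  simp [prodExp, Finset.mul_sum, mul_left_comm]

lemma prodExp_sum {ι : Type*} (I : Finset ι) (F : ι → (Fin m → S) → ℝ) :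
    prodExp w (fun s => ∑ i ∈ I, F i s) = ∑ i ∈ I, prodExp w (F i) := by
  simp only [prodExp, Finset.mul_sum]
  exact Finset.sum_comm

lemma prodExp_const (hw : ∑ a, w a = 1) (c : ℝ) :
    prodExp w (fun _ : Fin m → S => c) = c := by
  induction m with
  | zero => simp [prodExp_zero]
  | succ m ih => simp [prodExp_succ, ih, ← Finset.sum_mul, hw]

/-- The probabilistic method: it replaces random multipliers by a fixed good choice. -/
lemma exists_prodExp_le (hw : ∀ a, 0 ≤ w a) (hw1 : ∑ a, w a = 1) (F : (Fin m → S) → ℝ) :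
    ∃ s, prodExp w F ≤ F s := by
  by_contra! h
  have hS : Nonempty S := by
    by_contra hS
    rw [not_nonempty_iff] at hS
    simp at hw1
  obtain ⟨s, -, hs⟩ := Finset.exists_max_image Finset.univ F Finset.univ_nonempty
  have := prodExp_mono hw fun t => hs t (Finset.mem_univ t)
  rw [prodExp_const hw1] at this
  exact (h s).not_ge this

/-- An elementary form of Hoeffding's lemma. -/
lemma sum_exp_centered_le (hw : ∀ a, 0 ≤ w a) (hw1 : ∑ a, w a = 1) {g : S → ℝ} {c : ℝ}
    (hg : ∀ a b, |g a - g b| ≤ c) (l : ℝ) :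
    ∑ a, w a * Real.exp (l * (g a - ∑ b, w b * g b)) ≤ Real.exp (l ^ 2 * c ^ 2 / 2) := by
  -- Jensen's inequality replaces the mean by an independent copy; exchanging the two copies then
  -- turns `exp` into `cosh`, and `cosh x ≤ exp (x ^ 2 / 2)`.
  have hJ : ∀ a, Real.exp (l * (g a - ∑ b, w b * g b)) ≤
      ∑ b, w b * Real.exp (l * (g a - g b)) := by
    intro a
    have := convexOn_exp.map_sum_le (t := Finset.univ) (w := w) (p := fun b => l * (g a - g b))
      (fun b _ => hw b) hw1 (fun b _ => Set.mem_univ _)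
    simp only [smul_eq_mul] at this
    have h2 : ∑ b, w b * (l * (g a - g b)) = l * (g a * ∑ b, w b - ∑ b, w b * g b) := by
      rw [Finset.mul_sum, ← Finset.sum_sub_distrib, Finset.mul_sum]
      exact Finset.sum_congr rfl fun b _ => by ring
    rwa [h2, hw1, mul_one] at this
  have h1 : ∑ a, w a * Real.exp (l * (g a - ∑ b, w b * g b)) ≤
      ∑ a, ∑ b, w a * w b * Real.exp (l * (g a - g b)) := by
    refine Finset.sum_le_sum fun a _ => ?_
    simp only [mul_assoc, ← Finset.mul_sum]
    exact mul_le_mul_of_nonneg_left (hJ a) (hw a)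
  have h2 : ∑ a, ∑ b, w a * w b * Real.exp (l * (g a - g b)) =
      ∑ a, ∑ b, w a * w b * Real.exp (-(l * (g a - g b))) := by
    rw [Finset.sum_comm]
    refine Finset.sum_congr rfl fun a _ => Finset.sum_congr rfl fun b _ => ?_
    rw [mul_comm (w b), show l * (g b - g a) = -(l * (g a - g b)) by ring]
  have h3 : ∑ a, ∑ b, w a * w b * Real.exp (l * (g a - g b)) =
      ∑ a, ∑ b, w a * w b * Real.cosh (l * (g a - g b)) := by
    have : ∑ a, ∑ b, w a * w b * Real.cosh (l * (g a - g b)) =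
        (∑ a, ∑ b, w a * w b * Real.exp (l * (g a - g b)) +
        ∑ a, ∑ b, w a * w b * Real.exp (-(l * (g a - g b)))) / 2 := by
      simp only [← Finset.sum_add_distrib, Finset.sum_div, Real.cosh_eq]
      refine Finset.sum_congr rfl fun a _ => Finset.sum_congr rfl fun b _ => by ring
    rw [this, ← h2]; ring
  rw [h3] at h1
  refine h1.trans ?_
  have h4 : ∀ a b, Real.cosh (l * (g a - g b)) ≤ Real.exp (l ^ 2 * c ^ 2 / 2) := by
    intro a b
    refine (Real.cosh_le_exp_half_sq _).trans (Real.exp_le_exp.2 ?_)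
    have := sq_le_sq' (neg_le_of_abs_le (hg a b)) (le_of_abs_le (hg a b))
    rw [mul_pow]
    have := mul_le_mul_of_nonneg_left this (sq_nonneg l)
    linarith
  calc ∑ a, ∑ b, w a * w b * Real.cosh (l * (g a - g b))
      ≤ ∑ a, ∑ b, w a * w b * Real.exp (l ^ 2 * c ^ 2 / 2) := by
        refine Finset.sum_le_sum fun a _ => Finset.sum_le_sum fun b _ => ?_
        exact mul_le_mul_of_nonneg_left (h4 a b) (mul_nonneg (hw a) (hw b))
    _ = _ := by simp only [← Finset.sum_mul, ← Finset.mul_sum, hw1, mul_one, one_mul]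

/-- The exponential moment bound behind McDiarmid's inequality. -/
lemma prodExp_exp_centered_le (hw : ∀ a, 0 ≤ w a) (hw1 : ∑ a, w a = 1) {c : ℝ} (l : ℝ)
    (Z : (Fin m → S) → ℝ) (hZ : ∀ s t a, |Z (Function.update s t a) - Z s| ≤ c) :
    prodExp w (fun s => Real.exp (l * (Z s - prodExp w Z))) ≤
      Real.exp (m * (l ^ 2 * c ^ 2 / 2)) := by
  induction m with
  | zero => simp [prodExp_zero]
  | succ m ih =>
    -- `g` is the conditional mean given the first draw. The centered variable splits into `g` minus
    -- its mean, handled by the one-draw bound, and a remainder handled by induction.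
    set g : S → ℝ := fun a => prodExp w fun s => Z (Fin.cons a s) with hg
    have hZg : prodExp w Z = ∑ a, w a * g a := prodExp_succ Z
    have hgc : ∀ a b, |g a - g b| ≤ c := by
      intro a b
      have key : ∀ s : Fin m → S, |Z (Fin.cons a s) - Z (Fin.cons b s)| ≤ c := by
        intro s
        have := hZ (Fin.cons b s) 0 a
        rwa [Fin.update_cons_zero] at this
      rw [hg, ← prodExp_sub, abs_le]
      constructor
      · rw [← prodExp_const (m := m) hw1 (-c)]
        exact prodExp_mono hw fun s => neg_le_of_abs_le (key s)
      · conv_rhs => rw [← prodExp_const (m := m) hw1 c]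
        exact prodExp_mono hw fun s => le_of_abs_le (key s)
    have hstep : ∀ a, prodExp w (fun s => Real.exp (l * (Z (Fin.cons a s) - prodExp w Z))) ≤
        Real.exp (l * (g a - ∑ b, w b * g b)) * Real.exp (m * (l ^ 2 * c ^ 2 / 2)) := by
      intro a
      have h := ih (fun s => Z (Fin.cons a s)) fun s t b => by
        have := hZ (Fin.cons a s) t.succ b
        rwa [← Fin.cons_update] at this
      refine le_trans (le_of_eq ?_) (mul_le_mul_of_nonneg_left h (Real.exp_pos _).le)
      rw [← prodExp_const_mul, hZg]
      congr 1
      ext s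
      rw [← Real.exp_add]
      congr 1
      simp only [hg]
      ring
    rw [prodExp_succ]
    calc _ ≤ ∑ a, w a * (Real.exp (l * (g a - ∑ b, w b * g b)) *
          Real.exp (m * (l ^ 2 * c ^ 2 / 2))) :=
          Finset.sum_le_sum fun a _ => mul_le_mul_of_nonneg_left (hstep a) (hw a)
      _ = (∑ a, w a * Real.exp (l * (g a - ∑ b, w b * g b))) *
          Real.exp (m * (l ^ 2 * c ^ 2 / 2)) := by
          simp only [Finset.sum_mul, mul_assoc]
      _ ≤ Real.exp (l ^ 2 * c ^ 2 / 2) * Real.exp (m * (l ^ 2 * c ^ 2 / 2)) :=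
          mul_le_mul_of_nonneg_right (sum_exp_centered_le hw hw1 hgc l) (Real.exp_pos _).le
      _ = _ := by
          rw [← Real.exp_add]
          congr 1
          push_cast
          ring

open Classical in
/-- McDiarmid's inequality, with a non-optimal constant. -/
lemma mcdiarmid (hw : ∀ a, 0 ≤ w a) (hw1 : ∑ a, w a = 1) {c τ : ℝ} (hc : 0 < c) (hm : 0 < m)
    (hτ : 0 ≤ τ) (Z : (Fin m → S) → ℝ)
    (hZ : ∀ s t a, |Z (Function.update s t a) - Z s| ≤ c) :
    prodExp w (fun s => if prodExp w Z + τ < Z s then 1 else 0) ≤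
      Real.exp (-(τ ^ 2 / (2 * m * c ^ 2))) := by
  have hm' : (0 : ℝ) < m := by exact_mod_cast hm
  -- This minimizes the exponent `m l² c² / 2 - l τ` of the Chernoff bound.
  set l : ℝ := τ / (m * c ^ 2) with hl
  have hl0 : 0 ≤ l := by positivity
  have h1 : prodExp w (fun s => if prodExp w Z + τ < Z s then 1 else 0) ≤
      prodExp w (fun s => Real.exp (-(l * τ)) * Real.exp (l * (Z s - prodExp w Z))) := by
    refine prodExp_mono hw fun s => ?_
    rw [← Real.exp_add]
    split_ifs with h
    · apply Real.one_le_exp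
      nlinarith
    · exact (Real.exp_pos _).le
  rw [prodExp_const_mul] at h1
  refine h1.trans ((mul_le_mul_of_nonneg_left (prodExp_exp_centered_le hw hw1 l Z hZ)
    (Real.exp_pos _).le).trans (le_of_eq ?_))
  rw [← Real.exp_add]
  congr 1
  rw [hl]
  field_simp
  ring

end prodExp

/-- The sign `±1` coded by a boolean. -/
def sgn (b : Bool) : ℝ := if b then 1 else -1

/-- The uniform weights on `Bool`. -/
def coin (_ : Bool) : ℝ := 1 / 2

lemma coin_nonneg (b : Bool) : 0 ≤ coin b := by norm_num [coin]

lemma sum_coin : ∑ b, coin b = 1 := by norm_num [coin]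

lemma abs_sgn (b : Bool) : |sgn b| = 1 := by cases b <;> simp [sgn]

/-! ### Symmetrization, contraction and uniform deviations -/

section Deviation

/-- Uniform boundedness of a family of reals. -/
def BddFamily {ι : Type*} (f : ι → ℝ) : Prop := ∃ C, ∀ i, |f i| ≤ C

variable {ι : Type*}

lemma BddFamily.bddAbove {f : ι → ℝ} (h : BddFamily f) : BddAbove (Set.range f) := by
  obtain ⟨C, hC⟩ := h
  exact ⟨C, by rintro _ ⟨i, rfl⟩; exact (abs_le.1 (hC i)).2⟩

lemma BddFamily.add {f g : ι → ℝ} (hf : BddFamily f) (hg : BddFamily g) :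
    BddFamily fun i => f i + g i := by
  obtain ⟨C, hC⟩ := hf
  obtain ⟨D, hD⟩ := hg
  exact ⟨C + D, fun i => (abs_add_le _ _).trans (add_le_add (hC i) (hD i))⟩

lemma BddFamily.const_mul {f : ι → ℝ} (hf : BddFamily f) (c : ℝ) :
    BddFamily fun i => c * f i := by
  obtain ⟨C, hC⟩ := hf
  exact ⟨|c| * C, fun i => by
    rw [abs_mul]; exact mul_le_mul_of_nonneg_left (hC i) (abs_nonneg _)⟩

lemma BddFamily.sub {f g : ι → ℝ} (hf : BddFamily f) (hg : BddFamily g) :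
    BddFamily fun i => f i - g i := by
  simpa [sub_eq_add_neg] using hf.add (hg.const_mul (-1))

lemma BddFamily.sum {κ : Type*} (I : Finset κ) {f : κ → ι → ℝ} (hf : ∀ k, BddFamily (f k)) :
    BddFamily fun i => ∑ k ∈ I, f k i := by
  choose C hC using hf
  exact ⟨∑ k ∈ I, C k, fun i => (Finset.abs_sum_le_sum_abs _ _).trans
    (Finset.sum_le_sum fun k _ => hC k i)⟩

lemma abs_ciSup_sub_le [Nonempty ι] {f g : ι → ℝ} (hf : BddFamily f) (hg : BddFamily g) {c : ℝ}
    (h : ∀ i, |f i - g i| ≤ c) : |(⨆ i, f i) - ⨆ i, g i| ≤ c := by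
  rw [abs_le]
  constructor
  · rw [neg_le_sub_iff_le_add]
    refine ciSup_le fun i => ?_
    linarith [le_ciSup hf.bddAbove i, (abs_le.1 (h i)).1]
  · rw [sub_le_iff_le_add]
    refine ciSup_le fun i => ?_
    linarith [le_ciSup hg.bddAbove i, (abs_le.1 (h i)).2]

variable {S : Type*} [Fintype S] {w : S → ℝ} [Nonempty ι]

/-- Symmetrization and contraction in one coordinate. -/
lemma symmetrize_contract_one (hw : ∀ a, 0 ≤ w a) (hw1 : ∑ a, w a = 1) {L : ℝ}
    {b : ι → ℝ} {ℓ u : ι → S → ℝ} (hb : BddFamily b) (hℓ : ∀ s, BddFamily (ℓ · s))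
    (hu : ∀ s, BddFamily (u · s)) (hL : ∀ i j s, |ℓ i s - ℓ j s| ≤ L * |u i s - u j s|) :
    ∑ s, w s * (⨆ i, (b i + (∑ s', w s' * ℓ i s' - ℓ i s))) ≤
      ∑ s, w s * ∑ ε, coin ε * ⨆ i, (b i + sgn ε * (2 * L * u i s)) := by
  set p : S → ℝ := fun s => ⨆ i, (b i + 2 * ℓ i s) with hp
  set q : S → ℝ := fun s => ⨆ i, (b i - 2 * ℓ i s) with hq
  have hpb : ∀ s, BddAbove (Set.range fun i => b i + 2 * ℓ i s) := fun s =>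
    (hb.add ((hℓ s).const_mul 2)).bddAbove
  have hqb : ∀ s, BddAbove (Set.range fun i => b i - 2 * ℓ i s) := fun s =>
    (hb.sub ((hℓ s).const_mul 2)).bddAbove
  -- Half of `b` goes with the averaged copy and half with the current draw; the supremum of the sum
  -- is at most the sum of the suprema.
  have h1 : ∀ s, (⨆ i, (b i + (∑ s', w s' * ℓ i s' - ℓ i s))) ≤
      1 / 2 * ∑ s', w s' * p s' + 1 / 2 * q s := by
    intro s
    refine ciSup_le fun i => ?_
    have e1 : ∑ s', w s' * (b i + 2 * ℓ i s') ≤ ∑ s', w s' * p s' :=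
      Finset.sum_le_sum fun s' _ => mul_le_mul_of_nonneg_left (le_ciSup (hpb s') i) (hw s')
    have e2 : b i - 2 * ℓ i s ≤ q s := le_ciSup (hqb s) i
    have e3 : ∑ s', w s' * (b i + 2 * ℓ i s') = b i + 2 * ∑ s', w s' * ℓ i s' := by
      simp only [mul_add, Finset.sum_add_distrib, ← Finset.sum_mul, hw1, one_mul, Finset.mul_sum]
      congr 1
      exact Finset.sum_congr rfl fun _ _ => by ring
    linarith
  have h2 : ∀ s, 1 / 2 * p s + 1 / 2 * q s ≤
      ∑ ε, coin ε * ⨆ i, (b i + sgn ε * (2 * L * u i s)) := by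
    intro s
    simp only [Fintype.sum_bool, coin, sgn, if_true, one_mul, Bool.false_eq_true, if_false]
    have A : BddAbove (Set.range fun i => b i + 2 * L * u i s) :=
      (hb.add ((hu s).const_mul (2 * L))).bddAbove
    have B : BddAbove (Set.range fun i => b i + -1 * (2 * L * u i s)) :=
      (hb.add (((hu s).const_mul (2 * L)).const_mul (-1))).bddAbove
    -- Fix one index for each supremum. The Lipschitz bound replaces `ℓ i - ℓ j` by `L |u i - u j|`,
    -- and the sign of `u i - u j` decides which index goes to which supremum on the right.
    have : p s + q s ≤ (⨆ i, (b i + 2 * L * u i s)) + ⨆ i, (b i + -1 * (2 * L * u i s)) := by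
      refine ciSup_add_ciSup_le fun i j => ?_
      have hij := (le_abs_self _).trans (hL i j s)
      rcases abs_cases (u i s - u j s) with ⟨h, -⟩ | ⟨h, -⟩ <;> rw [h] at hij
      · linarith [le_ciSup A i, le_ciSup B j]
      · linarith [le_ciSup A j, le_ciSup B i]
    linarith
  calc _ ≤ ∑ s, w s * (1 / 2 * ∑ s', w s' * p s' + 1 / 2 * q s) :=
        Finset.sum_le_sum fun s _ => mul_le_mul_of_nonneg_left (h1 s) (hw s)
    _ = ∑ s, w s * (1 / 2 * p s + 1 / 2 * q s) := by
        simp only [mul_add, Finset.sum_add_distrib, ← Finset.sum_mul, hw1, one_mul]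
        congr 1
        rw [Finset.mul_sum]
        exact Finset.sum_congr rfl fun _ _ => by ring
    _ ≤ _ := Finset.sum_le_sum fun s _ => mul_le_mul_of_nonneg_left (h2 s) (hw s)

/-- Symmetrization and contraction for the supremum of a centered empirical process. -/
lemma symmetrize_contract (hw : ∀ a, 0 ≤ w a) (hw1 : ∑ a, w a = 1) {L : ℝ}
    {ℓ u : ι → S → ℝ} (hℓ : ∀ s, BddFamily (ℓ · s))
    (hu : ∀ s, BddFamily (u · s)) (hL : ∀ i j s, |ℓ i s - ℓ j s| ≤ L * |u i s - u j s|)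
    (m : ℕ) (b : ι → ℝ) (hb : BddFamily b) :
    prodExp w (fun s : Fin m → S => ⨆ i, (b i + ∑ t, (∑ s', w s' * ℓ i s' - ℓ i (s t)))) ≤
      prodExp w fun s : Fin m → S => prodExp coin fun ε =>
        ⨆ i, (b i + ∑ t, sgn (ε t) * (2 * L * u i (s t))) := by
  have hμ : BddFamily fun i => ∑ s', w s' * ℓ i s' :=
    BddFamily.sum _ fun s => (hℓ s).const_mul _
  induction m generalizing b with
  | zero => simp [prodExp_zero]
  | succ m ih =>
    rw [prodExp_succ]
    simp only [Fin.sum_univ_succ, Fin.cons_zero, Fin.cons_succ, ← add_assoc]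
    calc _ ≤ ∑ a, w a * prodExp w fun s : Fin m → S => prodExp coin fun ε =>
          ⨆ i, (b i + (∑ s', w s' * ℓ i s' - ℓ i a) +
            ∑ t, sgn (ε t) * (2 * L * u i (s t))) := by
          refine Finset.sum_le_sum fun a _ => mul_le_mul_of_nonneg_left ?_ (hw a)
          -- The offset `b` is arbitrary so that it can absorb the coordinate which is treated
          -- afterwards.
          exact ih _ (hb.add (hμ.sub (hℓ a)))
      _ = prodExp w fun s : Fin m → S => prodExp coin fun ε => ∑ a, w a *
          ⨆ i, (b i + ∑ t, sgn (ε t) * (2 * L * u i (s t)) +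
            (∑ s', w s' * ℓ i s' - ℓ i a)) := by
          simp only [prodExp_sum, prodExp_const_mul, add_right_comm]
      _ ≤ prodExp w fun s : Fin m → S => prodExp coin fun ε => ∑ a, w a * ∑ ε₀, coin ε₀ *
          ⨆ i, (b i + ∑ t, sgn (ε t) * (2 * L * u i (s t)) + sgn ε₀ * (2 * L * u i a)) := by
          refine prodExp_mono hw fun s => prodExp_mono coin_nonneg fun ε =>
            symmetrize_contract_one hw hw1 (hb.add (BddFamily.sum _ fun t => ?_)) hℓ hu hL
          exact ((hu (s t)).const_mul _).const_mul _
      _ = _ := by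
          rw [prodExp_succ]
          simp only [prodExp_succ (w := coin), Fin.cons_zero, Fin.cons_succ,
            prodExp_sum, prodExp_const_mul, add_right_comm]

/-- Massart's finite class lemma for Rademacher averages. -/
lemma massart {κ : Type*} [Fintype κ] [Nonempty κ] {m : ℕ} (P : κ → Fin m → ℝ)
    (hP : ∀ k t, |P k t| ≤ 1) {D : ℝ} (hD : 0 < D) (hκ : Real.log (Fintype.card κ) ≤ D)
    (hm : 0 < m) :
    prodExp coin (fun ε => ⨆ k, ∑ t, sgn (ε t) * P k t) ≤ √(2 * m * D) := by
  have hm' : (0 : ℝ) < m := by exact_mod_cast hm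
  set X : (Fin m → Bool) → ℝ := fun ε => ⨆ k, ∑ t, sgn (ε t) * P k t with hX
  -- This minimizes the bound `D / l + m l / 2` on the expected maximum.
  set l : ℝ := √(2 * D / m) with hl
  have hl0 : 0 < l := by positivity
  have hl2 : l ^ 2 = 2 * D / m := Real.sq_sqrt (by positivity)
  have hw : ∀ ε : Fin m → Bool, 0 ≤ ∏ t, coin (ε t) := fun ε =>
    Finset.prod_nonneg fun t _ => coin_nonneg _
  have hJ : Real.exp (l * prodExp coin X) ≤ prodExp coin fun ε => Real.exp (l * X ε) := by
    have h1 : ∑ ε : Fin m → Bool, ∏ t, coin (ε t) = 1 := by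
      simpa [prodExp] using prodExp_const (m := m) sum_coin 1
    have := convexOn_exp.map_sum_le (t := Finset.univ) (w := fun ε : Fin m → Bool => ∏ t, coin (ε t))
      (p := fun ε => l * X ε) (fun ε _ => hw ε) h1 (fun _ _ => Set.mem_univ _)
    rw [← prodExp_const_mul]
    exact this
  have hmax : ∀ ε, Real.exp (l * X ε) ≤ ∑ k, ∏ t, Real.exp (l * (sgn (ε t) * P k t)) := by
    intro ε
    obtain ⟨k, hk⟩ := exists_eq_ciSup_of_finite (f := fun k => ∑ t, sgn (ε t) * P k t)
    rw [hX]
    simp only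
    rw [← hk, Finset.mul_sum, Real.exp_sum]
    exact Finset.single_le_sum (f := fun k => ∏ t, Real.exp (l * (sgn (ε t) * P k t)))
      (fun k _ => Finset.prod_nonneg fun t _ => (Real.exp_pos _).le) (Finset.mem_univ k)
  have hprod : ∀ k, prodExp coin (fun ε : Fin m → Bool => ∏ t, Real.exp (l * (sgn (ε t) * P k t)))
      ≤ Real.exp (m * (l ^ 2 / 2)) := by
    intro k
    have : prodExp coin (fun ε : Fin m → Bool => ∏ t, Real.exp (l * (sgn (ε t) * P k t))) =
        ∏ t, Real.cosh (l * P k t) := by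
      simp only [prodExp, ← Finset.prod_mul_distrib]
      rw [← Fintype.prod_sum fun t b => coin b * Real.exp (l * (sgn b * P k t))]
      refine Finset.prod_congr rfl fun t _ => ?_
      simp [coin, sgn, Real.cosh_eq]
      ring
    rw [this, mul_comm (m : ℝ), Real.exp_mul, Real.rpow_natCast]
    calc _ ≤ ∏ _t : Fin m, Real.exp (l ^ 2 / 2) := by
          refine Finset.prod_le_prod (fun t _ => (Real.cosh_pos _).le) fun t _ => ?_
          refine (Real.cosh_le_exp_half_sq _).trans (Real.exp_le_exp.2 ?_)
          rw [mul_pow]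
          have := (sq_le_one_iff_abs_le_one _).2 (hP k t)
          nlinarith [sq_nonneg l]
      _ = _ := by simp
  have hfin : Real.exp (l * prodExp coin X) ≤ Real.exp (D + m * (l ^ 2 / 2)) := by
    refine hJ.trans ((prodExp_mono coin_nonneg hmax).trans ?_)
    rw [prodExp_sum, Real.exp_add]
    refine (Finset.sum_le_sum fun k _ => hprod k).trans ?_
    rw [Finset.sum_const, nsmul_eq_mul, Finset.card_univ]
    refine mul_le_mul_of_nonneg_right ?_ (Real.exp_pos _).le
    rw [← Real.log_le_iff_le_exp (by exact_mod_cast Fintype.card_pos)]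
    exact hκ
  rw [Real.exp_le_exp, hl2] at hfin
  have e1 : D + m * (2 * D / m / 2) = 2 * D := by field_simp; ring
  rw [e1] at hfin
  have e2 : √(2 * m * D) * l = 2 * D := by
    rw [hl, ← Real.sqrt_mul (by positivity), show 2 * m * D * (2 * D / m) = (2 * D) ^ 2 by
      field_simp, Real.sqrt_sq (by positivity)]
  by_contra! hcon
  have := mul_lt_mul_of_pos_right hcon hl0
  linarith

open Classical in
/-- A uniform deviation bound for an empirical process which is dominated, after contraction, by a
finite class. -/
lemma uniform_deviation (hw : ∀ a, 0 ≤ w a) (hw1 : ∑ a, w a = 1) {L B U D τ : ℝ}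
    {ℓ u : ι → S → ℝ} (hU : 0 < U) (hℓ : ∀ i s, |ℓ i s| ≤ U) (hu : ∀ s, BddFamily (u · s))
    (hL0 : 0 ≤ L) (hB : 0 ≤ B) (hL : ∀ i j s, |ℓ i s - ℓ j s| ≤ L * |u i s - u j s|)
    {κ : Type*} [Fintype κ] [Nonempty κ] (P : κ → S → ℝ) (hP : ∀ k s, |P k s| ≤ 1)
    (hD : 0 < D) (hκ : Real.log (Fintype.card κ) ≤ D) {m : ℕ} (hm : 0 < m)
    (hdom : ∀ (s : Fin m → S) (ε : Fin m → Bool) (i : ι), ∃ k,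
      ∑ t, sgn (ε t) * u i (s t) ≤ B * ∑ t, sgn (ε t) * P k (s t)) (hτ : 0 ≤ τ) :
    prodExp w (fun s : Fin m → S => if ∃ i, 2 * L * B * √(2 * m * D) + τ <
        ∑ t, (∑ s', w s' * ℓ i s' - ℓ i (s t)) then 1 else 0) ≤
      Real.exp (-(τ ^ 2 / (8 * m * U ^ 2))) := by
  have hℓb : ∀ s, BddFamily (ℓ · s) := fun s => ⟨U, fun i => hℓ i s⟩
  have hμ : BddFamily fun i => ∑ s', w s' * ℓ i s' :=
    BddFamily.sum _ fun s => (hℓb s).const_mul _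
  set Z : (Fin m → S) → ℝ := fun s => ⨆ i, ∑ t, (∑ s', w s' * ℓ i s' - ℓ i (s t)) with hZ
  have hfam : ∀ s : Fin m → S, BddFamily fun i => ∑ t, (∑ s', w s' * ℓ i s' - ℓ i (s t)) :=
    fun s => BddFamily.sum _ fun t => hμ.sub (hℓb (s t))
  have hEZ : prodExp w Z ≤ 2 * L * B * √(2 * m * D) := by
    have h := symmetrize_contract hw hw1 hℓb hu hL m (fun _ => 0) ⟨0, by simp⟩
    simp only [zero_add] at h
    refine h.trans ?_
    rw [← prodExp_const (m := m) hw1 (2 * L * B * √(2 * m * D))]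
    refine prodExp_mono hw fun s => ?_
    refine le_trans ?_ (mul_le_mul_of_nonneg_left (massart (fun k t => P k (s t))
      (fun k t => hP k (s t)) hD hκ hm) (by positivity : 0 ≤ 2 * L * B))
    rw [← prodExp_const_mul]
    refine prodExp_mono coin_nonneg fun ε => ciSup_le fun i => ?_
    obtain ⟨k, hk⟩ := hdom s ε i
    have e : ∑ t, sgn (ε t) * (2 * L * u i (s t)) = 2 * L * ∑ t, sgn (ε t) * u i (s t) := by
      rw [Finset.mul_sum]
      exact Finset.sum_congr rfl fun _ _ => by ring
    rw [e, mul_assoc (2 * L)]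
    refine mul_le_mul_of_nonneg_left (hk.trans (mul_le_mul_of_nonneg_left ?_ hB)) (by positivity)
    exact le_ciSup (f := fun k => ∑ t, sgn (ε t) * P k (s t)) (Set.finite_range _).bddAbove k
  -- Changing one draw alters a single loss value; the means cancel, so the change is at most `2 U`.
  have hMc := mcdiarmid hw hw1 (c := 2 * U) (by positivity) hm hτ Z fun s t a => by
    refine abs_ciSup_sub_le (hfam _) (hfam _) fun i => ?_
    rw [← Finset.sum_sub_distrib]
    rw [Finset.sum_eq_single t]
    · simp only [Function.update_self]
      have h1 := abs_le.1 (hℓ i a)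
      have h2 := abs_le.1 (hℓ i (s t))
      rw [abs_le]
      constructor <;> linarith
    · intro t' _ h
      simp [Function.update_of_ne h]
    · simp
  refine le_trans (prodExp_mono hw fun s => ?_) (hMc.trans (le_of_eq ?_))
  · split_ifs with h1 h2
    · exact le_rfl
    · obtain ⟨i, hi⟩ := h1
      exact absurd (lt_of_le_of_lt (by linarith) (hi.trans_le (le_ciSup (hfam s).bddAbove i))) h2
    · exact zero_le_one
    · exact le_rfl
  · congr 3
    ring

end Deviation

/-- The negative log-likelihood of the label `b` at the parameter `x`. -/
def loss (f : ℝ → ℝ) (b : Bool) (x : ℝ) : ℝ :=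
  if b = true then Real.log (1 / f x) else Real.log (1 / (1 - f x))

/-! ### The link function: Lipschitz loss and divergence bound -/

namespace IsLink

variable {f : ℝ → ℝ} {α x : ℝ}

lemma pos (hf : IsLink f α) (hx : x ∈ Set.Icc (-α) α) : 0 < f x :=
  lt_of_le_of_ne (hf.mem_Icc x).1 (hf.ne_zero x hx).symm

/-- The value `1` would be a global maximum of `f`, where the derivative vanishes. -/
lemma lt_one (hf : IsLink f α) (hx : x ∈ Set.Icc (-α) α) : f x < 1 := by
  refine lt_of_le_of_ne (hf.mem_Icc x).2 fun h => hf.deriv_ne_zero x hx ?_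
  refine IsLocalMax.deriv_eq_zero (Filter.Eventually.of_forall fun y => ?_)
  rw [h]
  exact (hf.mem_Icc y).2

lemma one_sub_pos (hf : IsLink f α) (hx : x ∈ Set.Icc (-α) α) : 0 < 1 - f x :=
  sub_pos.2 (hf.lt_one hx)

lemma mul_pos (hf : IsLink f α) (hx : x ∈ Set.Icc (-α) α) : 0 < f x * (1 - f x) :=
  _root_.mul_pos (hf.pos hx) (hf.one_sub_pos hx)

lemma deriv_pos (hf : IsLink f α) (hx : x ∈ Set.Icc (-α) α) : 0 < deriv f x :=
  lt_of_le_of_ne hf.monotone.deriv_nonneg (hf.deriv_ne_zero x hx).symm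

lemma steepness_le (hf : IsLink f α) (hx : x ∈ Set.Icc (-α) α) :
    |deriv f x| / (f x * (1 - f x)) ≤ Lconst f α :=
  le_csSup hf.bdd_L (Set.mem_image_of_mem _ hx)

lemma flatness_le (hf : IsLink f α) (hx : x ∈ Set.Icc (-α) α) :
    f x * (1 - f x) / deriv f x ^ 2 ≤ βconst f α :=
  le_csSup hf.bdd_β (Set.mem_image_of_mem _ hx)

lemma logRange_le (hf : IsLink f α) (hx : x ∈ Set.Icc (-α) α) :
    Real.log (1 / (f x * (1 - f x))) ≤ Uconst f α :=
  le_csSup hf.bdd_U (Set.mem_image_of_mem _ hx)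

lemma L_nonneg (hf : IsLink f α) (hα : 0 ≤ α) : 0 ≤ Lconst f α := by
  have h0 : (0 : ℝ) ∈ Set.Icc (-α) α := ⟨by linarith, hα⟩
  exact (div_nonneg (abs_nonneg _) (hf.mul_pos h0).le).trans (hf.steepness_le h0)

lemma β_pos (hf : IsLink f α) (hα : 0 ≤ α) : 0 < βconst f α := by
  have h0 : (0 : ℝ) ∈ Set.Icc (-α) α := ⟨by linarith, hα⟩
  exact (div_pos (hf.mul_pos h0) (pow_pos (hf.deriv_pos h0) 2)).trans_le (hf.flatness_le h0)

lemma U_pos (hf : IsLink f α) (hα : 0 ≤ α) : 0 < Uconst f α := by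
  have h0 : (0 : ℝ) ∈ Set.Icc (-α) α := ⟨by linarith, hα⟩
  refine (Real.log_pos ?_).trans_le (hf.logRange_le h0)
  rw [lt_div_iff₀ (hf.mul_pos h0)]
  nlinarith [hf.pos h0, hf.one_sub_pos h0]

/-- The losses of the two labels are nonnegative and add up to `logRange f x`. -/
lemma loss_mem (hf : IsLink f α) (hx : x ∈ Set.Icc (-α) α) (b : Bool) :
    loss f b x ∈ Set.Icc 0 (Uconst f α) := by
  have h1 : 0 ≤ Real.log (1 / f x) := by
    apply Real.log_nonneg
    rw [le_div_iff₀ (hf.pos hx)]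
    linarith [hf.lt_one hx]
  have h2 : 0 ≤ Real.log (1 / (1 - f x)) := by
    apply Real.log_nonneg
    rw [le_div_iff₀ (hf.one_sub_pos hx)]
    linarith [hf.pos hx]
  have h3 : Real.log (1 / (f x * (1 - f x))) = Real.log (1 / f x) + Real.log (1 / (1 - f x)) := by
    rw [← Real.log_mul (one_div_ne_zero (hf.pos hx).ne') (one_div_ne_zero (hf.one_sub_pos hx).ne')]
    congr 1
    field_simp
  have h4 := hf.logRange_le hx
  unfold loss
  split_ifs
  · exact ⟨h1, by linarith⟩
  · exact ⟨h2, by linarith⟩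

lemma hasDerivAt (hf : IsLink f α) (x : ℝ) : HasDerivAt f (deriv f x) x :=
  (hf.differentiable x).hasDerivAt

lemma hasDerivAt_loss (hf : IsLink f α) (hx : x ∈ Set.Icc (-α) α) (b : Bool) :
    HasDerivAt (loss f b) (if b = true then -(deriv f x / f x) else deriv f x / (1 - f x)) x := by
  cases b
  · have := (((hf.hasDerivAt x).const_sub 1).log (hf.one_sub_pos hx).ne').neg
    have e : loss f false = -fun y => Real.log (1 - f y) := by
      ext y
      simp [loss]
    rw [e]
    refine this.congr_deriv ?_
    simp [neg_div]
  · have := ((hf.hasDerivAt x).log (hf.pos hx).ne').neg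
    have e : loss f true = -fun y => Real.log (f y) := by
      ext y
      simp [loss]
    rw [e]
    refine this.congr_deriv ?_
    simp

lemma loss_lipschitz (hf : IsLink f α) {y : ℝ} (hx : x ∈ Set.Icc (-α) α)
    (hy : y ∈ Set.Icc (-α) α) (b : Bool) :
    |loss f b x - loss f b y| ≤ Lconst f α * |x - y| := by
  refine (convex_Icc (-α) α).norm_image_sub_le_of_norm_hasDerivWithin_le
    (fun z hz => (hf.hasDerivAt_loss hz b).hasDerivWithinAt) (fun z hz => ?_) hy hx
  refine le_trans ?_ (hf.steepness_le hz)
  have h1 := hf.pos hz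
  have h2 := hf.one_sub_pos hz
  rw [Real.norm_eq_abs]
  split_ifs
  · rw [abs_neg, abs_div, abs_of_pos h1]
    exact div_le_div_of_nonneg_left (abs_nonneg _) (hf.mul_pos hz) (by nlinarith)
  · rw [abs_div, abs_of_pos h2]
    exact div_le_div_of_nonneg_left (abs_nonneg _) (hf.mul_pos hz) (by nlinarith)

/-- The derivative of `√f - √(1 - f)` is `f' (√f + √(1 - f)) / (2 √f √(1 - f))`. Flatness gives `√f
√(1 - f) ≤ √β f'`, and `√f + √(1 - f) ≥ 1`. -/
lemma sub_le_sqrt_sub (hf : IsLink f α) (hα : 0 ≤ α) {y : ℝ} (hx : x ∈ Set.Icc (-α) α)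
    (hy : y ∈ Set.Icc (-α) α) (hxy : x ≤ y) :
    1 / (2 * √(βconst f α)) * (y - x) ≤
      (√(f y) - √(1 - f y)) - (√(f x) - √(1 - f x)) := by
  have hd : ∀ z ∈ Set.Icc (-α) α, HasDerivAt (fun z => √(f z) - √(1 - f z))
      (deriv f z / (2 * √(f z)) + deriv f z / (2 * √(1 - f z))) z := by
    intro z hz
    refine (((hf.hasDerivAt z).sqrt (hf.pos hz).ne').sub
      (((hf.hasDerivAt z).const_sub 1).sqrt (hf.one_sub_pos hz).ne')).congr_deriv ?_
    ring
  refine (convex_Icc (-α) α).mul_sub_le_image_sub_of_le_deriv (f := fun z => √(f z) - √(1 - f z))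
    (fun z hz => (hd z hz).continuousAt.continuousWithinAt)
    (fun z hz => (hd z (interior_subset hz)).differentiableAt.differentiableWithinAt)
    (fun z hz => ?_) x hx y hy hxy
  have hz' := interior_subset hz
  rw [(hd z hz').deriv]
  have hp := hf.pos hz'
  have hq := hf.one_sub_pos hz'
  have hD := hf.deriv_pos hz'
  have hβ := hf.β_pos hα
  have ha := Real.sqrt_pos.2 hp
  have hb := Real.sqrt_pos.2 hq
  have ha2 := Real.sq_sqrt hp.le
  have hb2 := Real.sq_sqrt hq.le
  have hB := Real.sqrt_pos.2 hβ
  set a := √(f z)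
  set b := √(1 - f z)
  have h1 : a * b ≤ √(βconst f α) * deriv f z := by
    have h := hf.flatness_le hz'
    rw [div_le_iff₀ (by positivity), ← hb2, ← ha2] at h
    refine le_of_sq_le_sq ?_ (by positivity)
    rw [mul_pow, mul_pow, Real.sq_sqrt hβ.le]
    exact h
  have h2 : 1 ≤ a + b := by nlinarith [_root_.mul_pos ha hb]
  rw [div_add_div _ _ (by positivity) (by positivity), div_le_div_iff₀ (by positivity)
    (by positivity)]
  have h3 : 1 * (a * b) ≤ (a + b) * (√(βconst f α) * deriv f z) :=
    mul_le_mul h2 h1 (by positivity) (by positivity)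
  nlinarith

/-- This is `log u ≤ u - 1` at `u = √q / √p`. Added over the two labels, it says that the divergence
dominates the squared Hellinger distance. -/
lemma mul_log_sub_ge {p q : ℝ} (hp : 0 < p) (hq : 0 < q) :
    2 * p - 2 * (√p * √q) ≤ p * (Real.log (1 / q) - Real.log (1 / p)) := by
  have ha := Real.sqrt_pos.2 hp
  have hb := Real.sqrt_pos.2 hq
  have h := Real.log_le_sub_one_of_pos (div_pos hb ha)
  rw [Real.log_div hb.ne' ha.ne', Real.log_sqrt hq.le, Real.log_sqrt hp.le] at h
  have h2 := mul_le_mul_of_nonneg_left h (by positivity : 0 ≤ 2 * p)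
  have h3 : p * (√q / √p) = √p * √q := by
    rw [mul_div_assoc', div_eq_iff ha.ne']
    nth_rewrite 1 [← Real.mul_self_sqrt hp.le]
    ring
  rw [one_div, one_div, Real.log_inv, Real.log_inv]
  linarith

/-- The Kullback-Leibler divergence dominates the squared distance of the parameters. -/
lemma sq_sub_le_kl (hf : IsLink f α) (hα : 0 ≤ α) {t : ℝ} (hx : x ∈ Set.Icc (-α) α)
    (ht : t ∈ Set.Icc (-α) α) :
    (x - t) ^ 2 ≤ 8 * βconst f α * (f t * (loss f true x - loss f true t) +
      (1 - f t) * (loss f false x - loss f false t)) := by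
  have h1 := mul_log_sub_ge (hf.pos ht) (hf.pos hx)
  have h2 := mul_log_sub_ge (hf.one_sub_pos ht) (hf.one_sub_pos hx)
  simp only [loss, if_true, Bool.false_eq_true, if_false]
  have hβ := hf.β_pos hα
  have hB := Real.sqrt_pos.2 hβ
  have hψ : (x - t) ^ 2 ≤ 4 * βconst f α *
      ((√(f x) - √(1 - f x)) - (√(f t) - √(1 - f t))) ^ 2 := by
    have key : ∀ y z : ℝ, y ∈ Set.Icc (-α) α → z ∈ Set.Icc (-α) α → y ≤ z →
        (z - y) ^ 2 ≤ 4 * βconst f α *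
          ((√(f z) - √(1 - f z)) - (√(f y) - √(1 - f y))) ^ 2 := by
      intro y z hy hz hyz
      have h := hf.sub_le_sqrt_sub hα hy hz hyz
      rw [one_div, inv_mul_le_iff₀ (by positivity)] at h
      have := pow_le_pow_left₀ (sub_nonneg.2 hyz) h 2
      rw [mul_pow, mul_pow, Real.sq_sqrt hβ.le] at this
      linarith
    rcases le_total x t with h | h
    · have := key x t hx ht h
      linarith
    · exact key t x ht hx h
  have e1 := Real.sq_sqrt (hf.pos hx).le
  have e2 := Real.sq_sqrt (hf.pos ht).le
  have e3 := Real.sq_sqrt (hf.one_sub_pos hx).le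
  have e4 := Real.sq_sqrt (hf.one_sub_pos ht).le
  set a := √(f x)
  set b := √(f t)
  set c := √(1 - f x)
  set d := √(1 - f t)
  -- The factor `2` here, times the `4` of `hψ`, is the constant `8`.
  have h3 : ((a - c) - (b - d)) ^ 2 ≤ 2 * ((a - b) ^ 2 + (c - d) ^ 2) := by
    nlinarith [sq_nonneg ((a - b) + (c - d))]
  have h4 : (a - b) ^ 2 + (c - d) ^ 2 = 2 - 2 * (b * a) - 2 * (d * c) := by linarith
  have h5 := mul_le_mul_of_nonneg_left h3 hβ.le
  have h6 := mul_le_mul_of_nonneg_left (add_le_add h1 h2) hβ.le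
  rw [h4] at h5
  linarith

end IsLink

/-! ### From uniform deviations to the estimation error -/

section Estimator

variable {d N m : ℕ} {f : ℝ → ℝ} {α : ℝ} {p : Idx d N → ℝ} {T : Tensor d N}

/-- The probability of the single measurement `(ω, b)`. -/
def obsWeight (f : ℝ → ℝ) (p : Idx d N → ℝ) (T : Tensor d N) (a : Idx d N × Bool) : ℝ :=
  p a.1 * if a.2 = true then f (T a.1) else 1 - f (T a.1)

lemma obsWeight_nonneg (hf : IsLink f α) (hp : ∀ ω, 0 ≤ p ω) (a : Idx d N × Bool) :
    0 ≤ obsWeight f p T a := by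
  refine mul_nonneg (hp _) ?_
  have := hf.mem_Icc (T a.1)
  split_ifs
  · exact this.1
  · linarith [this.2]

lemma sum_obsWeight (hp1 : ∑ ω, p ω = 1) : ∑ a, obsWeight f p T a = 1 := by
  rw [Fintype.sum_prod_type]
  simp only [obsWeight, Fintype.sum_bool, if_true, Bool.false_eq_true, if_false, ← mul_add,
    add_sub_cancel, mul_one, hp1]

lemma measurementLaw_singleton (hp : ∀ ω, 0 ≤ p ω) (a : Idx d N × Bool) :
    measurementLaw f p T {a} = ENNReal.ofReal (obsWeight f p T a) := by
  obtain ⟨ω, b⟩ := a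
  simp only [measurementLaw, Measure.coe_finsetSum, Finset.sum_apply, Measure.smul_apply,
    Measure.add_apply, smul_eq_mul, Measure.dirac_apply, Set.indicator, Set.mem_singleton_iff,
    Prod.mk.injEq, obsWeight, Pi.one_apply]
  rw [Finset.sum_eq_single ω]
  · rw [ENNReal.ofReal_mul (hp ω)]
    cases b <;> simp
  · intro ω' _ h
    simp [h]
  · simp

lemma isProbabilityMeasure_measurementLaw (hf : IsLink f α) (hp : ∀ ω, 0 ≤ p ω)
    (hp1 : ∑ ω, p ω = 1) : IsProbabilityMeasure (measurementLaw f p T) := by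
  constructor
  rw [← Finset.coe_univ, ← sum_measure_singleton]
  simp only [measurementLaw_singleton hp]
  rw [← ENNReal.ofReal_sum_of_nonneg fun a _ => obsWeight_nonneg hf hp a, sum_obsWeight hp1,
    ENNReal.ofReal_one]

open Classical in
lemma sampleLaw_real_eq (hf : IsLink f α) (hp : ∀ ω, 0 ≤ p ω) (hp1 : ∑ ω, p ω = 1)
    (E : Set (Fin m → Idx d N × Bool)) :
    (sampleLaw m f p T).real E = prodExp (obsWeight f p T) fun s => if s ∈ E then 1 else 0 := by
  have := isProbabilityMeasure_measurementLaw (T := T) hf hp hp1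
  have hs : ∀ s : Fin m → Idx d N × Bool,
      (sampleLaw m f p T).real {s} = ∏ t, obsWeight f p T (s t) := by
    intro s
    rw [measureReal_def, sampleLaw, Measure.pi_singleton, ENNReal.toReal_prod]
    refine Finset.prod_congr rfl fun t _ => ?_
    rw [measurementLaw_singleton hp, ENNReal.toReal_ofReal (obsWeight_nonneg hf hp _)]
  have : IsProbabilityMeasure (sampleLaw m f p T) := by
    unfold sampleLaw
    infer_instance
  have hE : E = ((Finset.univ.filter (· ∈ E) : Finset _) : Set (Fin m → Idx d N × Bool)) := by
    simp
  rw [hE, ← sum_measureReal_singleton, Finset.sum_filter]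
  simp [prodExp, hs]

lemma abs_apply_le_of_norm_le {X : Tensor d N} (h : ‖X‖ ≤ α) (ω : Idx d N) :
    X ω ∈ Set.Icc (-α) α :=
  abs_le.1 ((norm_le_pi_norm X ω).trans h)

/-- The error bound for a likelihood maximizer over a set whose Rademacher complexity is controlled
by a finite class. -/
theorem estimator_error (hm : 0 < m) (hα : 0 ≤ α) (hf : IsLink f α) (hp : ∀ ω, 0 ≤ p ω)
    (hp1 : ∑ ω, p ω = 1) {K : Set (Tensor d N)} (hK : ∀ X ∈ K, ‖X‖ ≤ α) (hT : T ∈ K)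
    {κ : Type*} [Fintype κ] [Nonempty κ] (P : κ → Tensor d N) (hP : ∀ k ω, |P k ω| ≤ 1)
    {B D : ℝ} (hB : 0 ≤ B) (hD : 0 < D) (hκ : Real.log (Fintype.card κ) ≤ D)
    (hdom : ∀ A : Tensor d N, ∀ X ∈ K, ∃ k, ∑ ω, A ω * X ω ≤ B * ∑ ω, A ω * P k ω)
    {δ : ℝ} (hδ : 0 < δ) :
    1 - δ < (sampleLaw m f p T).real {s | ∀ X, IsEstimator f s K X →
      weightedSqError p T X ≤ 8 * βconst f α *
        (2 * Lconst f α * B * √(2 * D / m) + √8 * Uconst f α * √(Real.log (4 / δ) / m))} := by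
  classical
  -- For `δ > 1` the claim is trivial; otherwise `log (4 / δ)` is positive.
  rcases lt_or_ge 1 δ with h1 | h1
  · exact (sub_neg.2 h1).trans_le measureReal_nonneg
  have hm' : (0 : ℝ) < m := by exact_mod_cast hm
  have hlog : 0 < Real.log (4 / δ) := by
    apply Real.log_pos
    rw [lt_div_iff₀ hδ]
    linarith
  have hU := hf.U_pos hα
  have hL := hf.L_nonneg hα
  have hβ := hf.β_pos hα
  have hw := obsWeight_nonneg (T := T) hf hp
  have hw1 := sum_obsWeight (f := f) (T := T) hp1
  have hmem : ∀ (X : K) ω, X.1 ω ∈ Set.Icc (-α) α := fun X =>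
    abs_apply_le_of_norm_le (hK X.1 X.2)
  have hTm : ∀ ω, T ω ∈ Set.Icc (-α) α := abs_apply_le_of_norm_le (hK T hT)
  -- The excess loss over the truth is bounded by `U` in absolute value, being a difference of two
  -- values in `[0, U]`.
  set ℓ : K → Idx d N × Bool → ℝ := fun X a => loss f a.2 (X.1 a.1) - loss f a.2 (T a.1) with hℓ
  -- Chosen so that the McDiarmid tail equals `δ / 4`.
  set τ : ℝ := √8 * Uconst f α * √(m * Real.log (4 / δ)) with hτ
  have : Nonempty K := ⟨⟨T, hT⟩⟩
  have key := uniform_deviation hw hw1 (L := Lconst f α) (B := B) (τ := τ) (D := D)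
    (ℓ := ℓ) (u := fun X a => X.1 a.1) (m := m) hU
    (fun X a => by
      have h1 := hf.loss_mem (hmem X a.1) a.2
      have h2 := hf.loss_mem (hTm a.1) a.2
      simp only [hℓ]
      rw [abs_le]
      constructor <;> linarith [h1.1, h1.2, h2.1, h2.2])
    (fun a => ⟨α, fun X => abs_le.2 (hmem X a.1)⟩) hL hB
    (fun X Y a => by
      simp only [hℓ, sub_sub_sub_cancel_right]
      exact hf.loss_lipschitz (hmem X a.1) (hmem Y a.1) a.2)
    (fun k a => P k a.1) (fun k a => hP k a.1) hD hκ hm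
    (fun s ε X => by
      -- Collecting the signs by observed index turns the Rademacher sum into a linear functional of
      -- the tensor.
      obtain ⟨k, hk⟩ := hdom (fun ω => ∑ t, if (s t).1 = ω then sgn (ε t) else 0) X.1 X.2
      refine ⟨k, ?_⟩
      have e : ∀ Y : Tensor d N, ∑ ω, (∑ t, if (s t).1 = ω then sgn (ε t) else 0) * Y ω =
          ∑ t, sgn (ε t) * Y (s t).1 := by
        intro Y
        simp only [Finset.sum_mul]
        rw [Finset.sum_comm]
        simp
      rwa [e, e] at hk)
    (by positivity)
  have hexp : Real.exp (-(τ ^ 2 / (8 * m * Uconst f α ^ 2))) = δ / 4 := by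
    rw [hτ, mul_pow, mul_pow, Real.sq_sqrt (by norm_num), Real.sq_sqrt (by positivity)]
    have : 8 * Uconst f α ^ 2 * (m * Real.log (4 / δ)) / (8 * m * Uconst f α ^ 2) =
        Real.log (4 / δ) := by
      field_simp
    rw [this, Real.exp_neg, Real.exp_log (by positivity), inv_div]
  rw [hexp] at key
  have hbad : 1 - (sampleLaw m f p T).real {s | ∀ X, IsEstimator f s K X →
      weightedSqError p T X ≤ 8 * βconst f α *
        (2 * Lconst f α * B * √(2 * D / m) + √8 * Uconst f α * √(Real.log (4 / δ) / m))} ≤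
      δ / 4 := by
    refine le_trans ?_ key
    rw [sampleLaw_real_eq hf hp hp1]
    nth_rewrite 1 [← prodExp_const (m := m) hw1 1]
    rw [← prodExp_sub]
    refine prodExp_mono hw fun s => ?_
    split_ifs with h2 h3 h3
    · simp
    · simp
    · simp
    · exfalso
      apply h2
      intro X hX
      have hX1 : X ∈ K := hX.1
      push Not at h3
      have hle := h3 ⟨X, hX1⟩
      have hmin := hX.2 T hT
      set μ : ℝ := ∑ a, obsWeight f p T a * ℓ ⟨X, hX1⟩ a with hμ
      have e1 : ∑ t, (μ - ℓ ⟨X, hX1⟩ (s t)) = m * μ - (negLogLik f s X - negLogLik f s T) := by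
        rw [Finset.sum_sub_distrib]
        simp only [hℓ, negLogLik, loss, Finset.sum_sub_distrib, Finset.sum_const, Finset.card_univ,
          Fintype.card_fin, nsmul_eq_mul]
      rw [e1] at hle
      -- The mean excess loss `μ` is the average over `ω` of the divergences between the label laws.
      have e2 : weightedSqError p T X ≤ 8 * βconst f α * μ := by
        rw [hμ, Fintype.sum_prod_type, Finset.mul_sum]
        refine Finset.sum_le_sum fun ω _ => ?_
        have := mul_le_mul_of_nonneg_left (hf.sq_sub_le_kl hα (hmem ⟨X, hX1⟩ ω) (hTm ω)) (hp ω)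
        simp only [Fintype.sum_bool, obsWeight, hℓ, if_true, Bool.false_eq_true, if_false]
        linarith
      refine e2.trans (mul_le_mul_of_nonneg_left ?_ (by positivity))
      -- Off the bad event `m μ` exceeds the empirical excess loss by at most the deviation, and for
      -- a minimizer that excess loss is nonpositive because `T ∈ K`.
      have e3 : μ ≤ (2 * Lconst f α * B * √(2 * m * D) + τ) / m := by
        rw [le_div_iff₀ hm']
        linarith
      refine e3.trans (le_of_eq ?_)
      have e4 : ∀ x : ℝ, √(m * x) / m = √(x / m) := by
        intro x
        rw [div_eq_iff hm'.ne']
        nth_rewrite 3 [← Real.sqrt_sq hm'.le]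
        rw [← Real.sqrt_mul' _ (by positivity)]
        congr 1
        field_simp
      rw [add_div, hτ, mul_div_assoc, mul_div_assoc, show 2 * m * D = m * (2 * D) by ring, e4, e4]
  linarith

end Estimator

/-! ### Bounded decompositions of low-rank tensors -/

/-- In a finite family of vectors of `ℝ^r`, at most `r` of them express all the others with
coefficients in `[-1, 1]`. -/
lemma exists_bounded_coeff {X : Type*} [Finite X] [Nonempty X] {r : ℕ} (g : X → Fin r → ℝ) :
    ∃ (i : Fin r → X) (W : X → Fin r → ℝ), (∀ n k, |W n k| ≤ 1) ∧
      ∀ n, g n = ∑ k, W n k • g (i k) := by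
  classical
  set V := Submodule.span ℝ (Set.range g) with hV
  set s := Module.finrank ℝ V with hs
  have hsr : s ≤ r := by
    have := Submodule.finrank_le V
    simpa using this
  obtain ⟨v, hv, hspan, hli⟩ := Submodule.exists_fun_fin_finrank_span_eq ℝ (Set.range g)
  choose i₀ hi₀ using hv
  let gV : X → V := fun n => ⟨g n, Submodule.subset_span ⟨n, rfl⟩⟩
  have hli' : LinearIndependent ℝ (gV ∘ i₀) := by
    refine LinearIndependent.of_comp V.subtype ?_
    have : ⇑V.subtype ∘ gV ∘ i₀ = v := by
      ext k
      simp [gV, hi₀]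
    rwa [this]
  let b : Module.Basis (Fin s) ℝ V :=
    basisOfLinearIndependentOfCardEqFinrank' (gV ∘ i₀) hli' (by simp [hs])
  -- A subfamily of maximal volume. By Cramer's rule each coefficient is a ratio of two determinants
  -- whose denominator is maximal in absolute value.
  obtain ⟨i, hi⟩ := Finite.exists_max fun i : Fin s → X => |b.det (gV ∘ i)|
  have hne : b.det (gV ∘ i) ≠ 0 := by
    intro h0
    have := hi i₀
    rw [h0, abs_zero] at this
    have hb : gV ∘ i₀ = b := by simp [b]
    rw [hb, b.det_self] at this
    norm_num at this
  obtain ⟨hli2, hsp2⟩ := (Module.Basis.is_basis_iff_det b).2 (isUnit_iff_ne_zero.2 hne)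
  let e : Module.Basis (Fin s) ℝ V := Module.Basis.mk hli2 hsp2.ge
  have he : ∀ k, e k = gV (i k) := fun k => by simp [e]
  have hW : ∀ n k, |e.repr (gV n) k| ≤ 1 := by
    intro n k
    have h1 : b.det (Function.update (gV ∘ i) k (gV n)) = e.repr (gV n) k * b.det (gV ∘ i) := by
      have hx : gV n = ∑ j, e.repr (gV n) j • (gV ∘ i) j := by
        conv_lhs => rw [← e.sum_repr (gV n)]
        simp [he]
      conv_lhs => rw [hx]
      rw [AlternatingMap.map_update_sum, Finset.sum_eq_single k]
      · rw [AlternatingMap.map_update_smul, Function.update_eq_self, smul_eq_mul]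
      · intro j _ hj
        rw [AlternatingMap.map_update_smul, AlternatingMap.map_update_self _ _ hj.symm, smul_zero]
      · simp
    have h2 := hi (Function.update i k n)
    have h3 : gV ∘ Function.update i k n = Function.update (gV ∘ i) k (gV n) :=
      Function.comp_update _ _ _ _
    simp only [h3, h1, abs_mul] at h2
    exact le_of_mul_le_mul_right (by linarith) (abs_pos.2 hne)
  -- The span may have dimension `s < r`; the remaining positions get coefficient zero.
  have hinj := Fin.castLE_injective hsr
  refine ⟨Function.extend (Fin.castLE hsr) i fun _ => Classical.arbitrary X,
    fun n => Function.extend (Fin.castLE hsr) (fun k => e.repr (gV n) k) 0, fun n k => ?_,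
    fun n => ?_⟩
  · by_cases hk : ∃ k', Fin.castLE hsr k' = k
    · obtain ⟨k', rfl⟩ := hk
      beta_reduce
      rw [hinj.extend_apply]
      exact hW n k'
    · beta_reduce
      rw [Function.extend_apply' _ _ _ hk]
      simp
  · rw [← Fintype.sum_of_injective _ hinj (fun k => e.repr (gV n) k • g (i k))]
    · have := congrArg V.subtype (e.sum_repr (gV n))
      simp only [map_sum, map_smul, he] at this
      exact this.symm
    · intro k hk
      beta_reduce
      rw [Function.extend_apply' _ _ _ hk, Pi.zero_apply, zero_smul]
    · intro k
      beta_reduce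
      rw [hinj.extend_apply, hinj.extend_apply]

/-- A tensor of rank at most `r` is a combination of `r ^ (d - 1)` bounded rank-one tensors. -/
lemma exists_bounded_decomposition {N r : ℕ} [Nonempty (Fin N)] {α : ℝ} (hα : 0 ≤ α) (d : ℕ)
    (T : Tensor (d + 1) N) (u : Fin r → Fin (d + 1) → Fin N → ℝ)
    (hu : ∀ ω, T ω = ∑ i, ∏ j, u i j (ω j)) (hT : ∀ ω, |T ω| ≤ α) :
    ∃ w : (Fin d → Fin r) → Fin (d + 1) → Fin N → ℝ, (∀ k j n, |w k j n| ≤ 1) ∧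
      ∀ ω, T ω = α * ∑ k, ∏ j, w k j (ω j) := by
  induction d with
  | zero =>
    -- An order-one tensor is its own only term. For `α = 0` the division returns zero, which is
    -- right because `T` vanishes.
    refine ⟨fun _ _ n => T (fun _ => n) / α, fun _ _ n => ?_, fun ω => ?_⟩
    · rw [abs_div, abs_of_nonneg hα]
      exact div_le_one_of_le₀ (hT _) hα
    · have hω : (fun _ => ω 0) = ω := by
        ext j
        rw [Fin.fin_one_eq_zero j]
      have hsum : ∑ _k : Fin 0 → Fin r, ∏ j : Fin (0 + 1), T (fun _ => ω j) / α = T ω / α := by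
        simp [hω]
      rw [hsum]
      rcases hα.eq_or_lt with h | h
      · have := hT ω
        rw [← h] at this ⊢
        simpa using this
      · field_simp
  | succ d ih =>
    obtain ⟨i, W, hW, hg⟩ := exists_bounded_coeff fun (n : Fin N) (k : Fin r) => u k 0 n
    have hslice : ∀ n (ω : Idx (d + 1) N), T (Fin.cons n ω) = ∑ k, W n k * T (Fin.cons (i k) ω) := by
      intro n ω
      simp only [hu, Fin.prod_univ_succ, Fin.cons_zero, Fin.cons_succ, Finset.mul_sum]
      rw [Finset.sum_comm]
      refine Finset.sum_congr rfl fun l _ => ?_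
      have := congrFun (hg n) l
      simp only [Finset.sum_apply, Pi.smul_apply, smul_eq_mul] at this
      rw [this, Finset.sum_mul]
      exact Finset.sum_congr rfl fun k _ => by ring
    have hk := fun k : Fin r => ih (fun ω => T (Fin.cons (i k) ω))
      -- Fixing the first index gives an order `d + 1` slice with `r` terms: the frozen factor is a
      -- scalar, merged into the next mode.
      (fun l j n => if j = 0 then u l 0 (i k) * u l 1 n else u l j.succ n)
      (fun ω => by
        rw [hu]
        refine Finset.sum_congr rfl fun l _ => ?_
        rw [Fin.prod_univ_succ, Fin.prod_univ_succ, Fin.prod_univ_succ]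
        simp [Fin.succ_ne_zero, mul_assoc])
      (fun ω => hT _)
    choose w hw hTw using hk
    refine ⟨fun k => Fin.cons (fun n => W n (k 0)) (w (k 0) fun t => k t.succ), fun k j n => ?_,
      fun ω => ?_⟩
    · refine Fin.cases ?_ (fun j => ?_) j
      · exact hW _ _
      · exact hw _ _ _ _
    · rw [← Fin.cons_self_tail ω, hslice, sum_fin_succ_fun, Finset.mul_sum]
      refine Finset.sum_congr rfl fun k _ => ?_
      rw [hTw]
      simp only [Fin.prod_univ_succ (n := d + 1), Fin.cons_zero, Fin.cons_succ, Finset.mul_sum]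
      exact Finset.sum_congr rfl fun _ _ => by ring

/-! ### Attaining the rank -/

section Rank

variable {d N : ℕ}

/-- The expansion in products of standard basis vectors shows that the set defining the rank is
nonempty, so its infimum is attained. -/
lemma exists_rank_decomposition (T : Tensor d N) :
    ∃ (c : Fin (rank T) → ℝ) (u : Fin (rank T) → Fin d → EuclideanSpace ℝ (Fin N)),
      (∀ i j, ‖u i j‖ = 1) ∧ ∀ ω, T ω = ∑ i, c i * ∏ j : Fin d, u i j (ω j) := by
  refine Nat.sInf_mem (s := {r : ℕ | ∃ (c : Fin r → ℝ)
    (u : Fin r → Fin d → EuclideanSpace ℝ (Fin N)),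
    (∀ i j, ‖u i j‖ = 1) ∧ ∀ ω, T ω = ∑ i : Fin r, c i * ∏ j : Fin d, u i j (ω j)}) ?_
  let e := Fintype.equivFin (Idx d N)
  refine ⟨Fintype.card (Idx d N), fun i => T (e.symm i),
    fun i j => EuclideanSpace.single (e.symm i j) 1, fun i j => by simp, fun ω => ?_⟩
  rw [Finset.sum_eq_single (e ω)]
  · simp
  · intro i _ hi
    have : ∃ j, ω j ≠ e.symm i j := by
      by_contra! h
      exact hi (by rw [funext h]; simp)
    obtain ⟨j, hj⟩ := this
    rw [Finset.prod_eq_zero (Finset.mem_univ j), mul_zero]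
    simp [hj]
  · simp

lemma exists_rank_decomposition' (T : Tensor (d + 1) N) :
    ∃ u : Fin (rank T) → Fin (d + 1) → Fin N → ℝ, ∀ ω, T ω = ∑ i, ∏ j, u i j (ω j) := by
  obtain ⟨c, u, -, h⟩ := exists_rank_decomposition T
  refine ⟨fun i => Fin.cons (c i • (u i 0 : Fin N → ℝ)) fun j => u i j.succ, fun ω => ?_⟩
  rw [h]
  simp [Fin.prod_univ_succ, mul_assoc]

end Rank

/-! ### Bounding the max-qnorm by the rank -/

section MaxNorm

variable {d N : ℕ}

lemma rowNorm_nonneg {k : ℕ} (U : Matrix (Fin N) (Fin k) ℝ) : 0 ≤ rowNorm U :=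
  Real.iSup_nonneg fun _ => Real.sqrt_nonneg _

lemma sum_sq_le_rowNorm_sq {k : ℕ} (U : Matrix (Fin N) (Fin k) ℝ) (i : Fin N) :
    ∑ l, U i l ^ 2 ≤ rowNorm U ^ 2 := by
  have h := le_ciSup (f := fun i => √(∑ l, U i l ^ 2)) (Set.finite_range _).bddAbove i
  exact (Real.sqrt_le_left (rowNorm_nonneg U)).1 h

lemma maxQNorm_le {ι : Type*} [Fintype ι] {T : Tensor d N} (U : Fin d → Fin N → ι → ℝ)
    (hT : ∀ ω, T ω = ∑ l, ∏ j, U j (ω j) l) {B : Fin d → ℝ} (hB : ∀ j, 0 ≤ B j)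
    (hU : ∀ j i, ∑ l, U j i l ^ 2 ≤ B j ^ 2) : maxQNorm T ≤ ∏ j, B j := by
  let e := Fintype.equivFin ι
  let V : Fin d → Matrix (Fin N) (Fin (Fintype.card ι)) ℝ := fun j =>
    Matrix.of fun i l => U j i (e.symm l)
  have hle : maxQNorm T ≤ ∏ j, rowNorm (V j) := by
    refine csInf_le ⟨0, ?_⟩ ⟨Fintype.card ι, V, ?_, rfl⟩
    · rintro _ ⟨k, U, -, rfl⟩
      exact Finset.prod_nonneg fun j _ => rowNorm_nonneg _
    · ext ω
      rw [hT, outer]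
      exact (Fintype.sum_equiv e.symm _ _ fun _ => rfl).symm
  refine hle.trans (Finset.prod_le_prod (fun j _ => rowNorm_nonneg _) fun j _ => ?_)
  refine Real.iSup_le (fun i => ?_) (hB j)
  refine (Real.sqrt_le_left (hB j)).2 (le_trans (le_of_eq ?_) (hU j i))
  exact Fintype.sum_equiv e.symm _ _ fun _ => rfl

lemma exists_maxQNorm_lt {T : Tensor (d + 1) N} {x : ℝ} (hx : maxQNorm T < x) :
    ∃ (k : ℕ) (U : Fin (d + 1) → Matrix (Fin N) (Fin k) ℝ),
      T = outer U ∧ ∏ j, rowNorm (U j) < x := by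
  have hne : {x : ℝ | ∃ (k : ℕ) (U : Fin (d + 1) → Matrix (Fin N) (Fin k) ℝ),
      T = outer U ∧ x = ∏ j, rowNorm (U j)}.Nonempty := by
    obtain ⟨u, hu⟩ := exists_rank_decomposition' T
    exact ⟨_, _, fun j => Matrix.of fun i l => u l j i, funext hu, rfl⟩
  obtain ⟨_, ⟨k, U, hU, rfl⟩, h⟩ := exists_lt_of_csInf_lt hne hx
  exact ⟨k, U, hU, h⟩

lemma maxQNorm_nonneg (T : Tensor d N) : 0 ≤ maxQNorm T := by
  refine Real.sInf_nonneg ?_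
  rintro _ ⟨k, U, -, rfl⟩
  exact Finset.prod_nonneg fun j _ => rowNorm_nonneg _

/-- The terms serve as columns: entries at most one give rows of norm at most `√(card κ)`, and the
scalar `α` is put on the first factor. -/
lemma maxQNorm_le_of_decomposition {κ : Type*} [Fintype κ] {α : ℝ} (hα : 0 ≤ α)
    {T : Tensor (d + 1) N} (w : κ → Fin (d + 1) → Fin N → ℝ) (hw : ∀ k j n, |w k j n| ≤ 1)
    (hT : ∀ ω, T ω = α * ∑ k, ∏ j, w k j (ω j)) :
    maxQNorm T ≤ α * √(Fintype.card κ) ^ (d + 1) := by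
  have h := maxQNorm_le (T := T) (B := Fin.cons (α * √(Fintype.card κ)) fun _ => √(Fintype.card κ))
    (fun j n k => (Fin.cons (α * w k 0 n) (fun j => w k j.succ n) : Fin (d + 1) → ℝ) j)
    (fun ω => by simp [hT, Fin.prod_univ_succ, Finset.mul_sum, mul_assoc])
    (fun j => by
      refine Fin.cases ?_ (fun j => ?_) j
      · exact mul_nonneg hα (Real.sqrt_nonneg _)
      · exact Real.sqrt_nonneg _)
    (fun j n => by
      have hsum : ∀ j, ∑ k, w k j n ^ 2 ≤ Fintype.card κ := by
        intro j
        refine (Finset.sum_le_card_nsmul _ _ 1 fun k _ => ?_).trans (by simp)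
        exact (sq_le_one_iff_abs_le_one _).2 (hw k j n)
      refine Fin.cases ?_ (fun j => ?_) j
      · simp only [Fin.cons_zero, mul_pow, ← Finset.mul_sum]
        rw [Real.sq_sqrt (by positivity)]
        exact mul_le_mul_of_nonneg_left (hsum 0) (sq_nonneg α)
      · simp only [Fin.cons_succ]
        rw [Real.sq_sqrt (by positivity)]
        exact hsum _)
  refine h.trans (le_of_eq ?_)
  simp [Fin.prod_univ_succ, pow_succ', mul_assoc]

lemma maxQNorm_le_radiusMax {r : ℕ} {α : ℝ} {T : Tensor (d + 2) N} (hr : rank T ≤ r)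
    (hT : ‖T‖ ≤ α) : maxQNorm T ≤ radiusMax (d + 2) r α := by
  have hα : 0 ≤ α := (norm_nonneg T).trans hT
  rcases isEmpty_or_nonempty (Fin N) with hN | hN
  · refine (maxQNorm_le (B := fun _ => 0) (fun _ n (_ : Empty) => 0)
      (fun ω => (hN.false (ω 0)).elim) (fun _ => le_rfl) (fun _ _ => by simp)).trans ?_
    rw [Finset.prod_const, Finset.card_univ, Fintype.card_fin, zero_pow (by positivity)]
    exact mul_nonneg (Real.sqrt_nonneg _) hα
  · obtain ⟨u, hu⟩ := exists_rank_decomposition' T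
    obtain ⟨w, hw, hTw⟩ := exists_bounded_decomposition hα (d + 1) T u hu
      fun ω => (norm_le_pi_norm T ω).trans hT
    refine (maxQNorm_le_of_decomposition hα w hw hTw).trans ?_
    rw [radiusMax, mul_comm]
    refine mul_le_mul_of_nonneg_right ?_ hα
    refine Real.le_sqrt_of_sq_le ?_
    rw [← pow_mul, mul_comm, pow_mul, Real.sq_sqrt (by positivity)]
    simp only [Fintype.card_pi, Fintype.card_fin, Finset.prod_const, Finset.card_univ]
    push_cast
    rw [← pow_mul]
    norm_cast
    refine (Nat.pow_le_pow_left hr _).trans ?_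
    -- With `D = d + 2` the construction gives the exponent `D (D - 1)`, which is at most `D ^ 2 -
    -- 2` because `D ≥ 2`.
    have he : (d + 1) * (d + 1 + 1) ≤ (d + 2) ^ 2 - 2 := by
      have : (d + 2) ^ 2 = (d + 1) * (d + 1 + 1) + (d + 2) := by ring
      omega
    rcases Nat.eq_zero_or_pos r with h0 | h0
    · subst h0
      rw [zero_pow (by positivity)]
      exact Nat.zero_le _
    · exact Nat.pow_le_pow_right h0 he

end MaxNorm

/-! ### Sign tensors and the M-norm -/

section MNorm

variable {d N : ℕ}

/-- The outer product of `d` sign vectors. -/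
def signProd (σ : Fin d → Fin N → Bool) : Tensor d N := fun ω => ∏ j, sgn (σ j (ω j))

lemma abs_signProd (σ : Fin d → Fin N → Bool) (ω : Idx d N) : |signProd σ ω| = 1 := by
  simp [signProd, Finset.abs_prod, abs_sgn]

lemma signProd_mem [Nonempty (Fin N)] (σ : Fin d → Fin N → Bool) :
    signProd σ ∈ signTensors d N := by
  have hN : (0 : ℝ) < N := by exact_mod_cast Fin.pos_iff_nonempty.2 ‹_›
  have hs := Real.sqrt_pos.2 hN
  refine ⟨fun ω => (abs_eq zero_le_one).1 (abs_signProd σ ω), le_antisymm (Nat.sInf_le ?_) ?_⟩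
  · refine ⟨fun _ => √N ^ d, fun _ j => WithLp.toLp 2 fun i => sgn (σ j i) / √N, fun _ j => ?_,
      fun ω => ?_⟩
    · rw [EuclideanSpace.norm_eq, Real.sqrt_eq_one]
      simp only [norm_div, Real.norm_eq_abs, abs_sgn, abs_of_pos hs, div_pow, one_pow,
        Real.sq_sqrt hN.le, Finset.sum_const, Finset.card_univ, Fintype.card_fin, nsmul_eq_mul]
      field_simp
    · simp only [Finset.univ_unique, Finset.sum_singleton, Finset.prod_div_distrib,
        Finset.prod_const, Finset.card_univ, Fintype.card_fin, signProd]
      field_simp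
  · by_contra! h
    obtain ⟨c, u, -, hu⟩ := exists_rank_decomposition (signProd σ)
    have hω := hu fun _ => Classical.arbitrary _
    have hempty : IsEmpty (Fin (rank (signProd σ))) := by
      rw [Nat.lt_one_iff.1 h]
      infer_instance
    rw [Finset.univ_eq_empty, Finset.sum_empty] at hω
    have := abs_signProd σ fun _ => Classical.arbitrary _
    rw [hω] at this
    norm_num at this

/-- No factor of a product of absolute value one vanishes, so each factor is its sign times its
absolute value, and the absolute values multiply to one. -/
lemma exists_signProd_eq {T : Tensor (d + 1) N} (hT : T ∈ signTensors (d + 1) N) :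
    ∃ σ, T = signProd σ := by
  obtain ⟨h1, h2⟩ := hT
  have hdec := exists_rank_decomposition' T
  rw [h2] at hdec
  obtain ⟨u, hu⟩ := hdec
  refine ⟨fun j i => decide (0 < u 0 j i), funext fun ω => ?_⟩
  have hω : T ω = ∏ j, u 0 j (ω j) := by
    rw [hu]
    simp
  have habs : |T ω| = 1 := by rcases h1 ω with h | h <;> simp [h]
  have hsgn : ∀ x : ℝ, sgn (decide (0 < x)) * |x| = x ∨ x = 0 := by
    intro x
    rcases lt_trichotomy x 0 with h | h | h
    · left
      simp [sgn, h.not_gt, abs_of_neg h]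
    · exact Or.inr h
    · left
      simp [sgn, h, abs_of_pos h]
  have h3 : ∀ j, sgn (decide (0 < u 0 j (ω j))) * |u 0 j (ω j)| = u 0 j (ω j) := by
    intro j
    refine (hsgn _).resolve_right fun h => ?_
    rw [hω, Finset.prod_eq_zero (Finset.mem_univ j) h] at habs
    norm_num at habs
  calc T ω = ∏ j, sgn (decide (0 < u 0 j (ω j))) * |u 0 j (ω j)| := by
        rw [hω]
        exact Finset.prod_congr rfl fun j _ => (h3 j).symm
    _ = signProd (fun j i => decide (0 < u 0 j i)) ω := by
        rw [Finset.prod_mul_distrib, ← Finset.abs_prod, ← hω, habs, mul_one]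
        rfl

/-- A vector with entries in `[-1, 1]` is an average of sign vectors. -/
lemma sum_signs_eq {ι : Type*} [Fintype ι] [DecidableEq ι] (a : ι → ℝ) (i : ι) :
    ∑ s : ι → Bool, (∏ k, (1 + sgn (s k) * a k) / 2) * sgn (s i) = a i := by
  have h : ∀ s : ι → Bool, (∏ k, (1 + sgn (s k) * a k) / 2) * sgn (s i) =
      ∏ k, ((1 + sgn (s k) * a k) / 2 * if k = i then sgn (s k) else 1) := by
    intro s
    rw [Finset.prod_mul_distrib]
    simp
  simp only [h]
  rw [← Fintype.prod_sum fun k b => (1 + sgn b * a k) / 2 * if k = i then sgn b else 1,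
    Finset.prod_eq_single i]
  · simp [sgn]
    ring
  · intro k _ hk
    simp [hk, sgn]
    ring
  · simp

lemma sum_sign_weights {ι : Type*} [Fintype ι] [DecidableEq ι] (a : ι → ℝ) :
    ∑ s : ι → Bool, (∏ k, (1 + sgn (s k) * a k) / 2) = 1 := by
  rw [← Fintype.prod_sum fun k b => (1 + sgn b * a k) / 2]
  refine Finset.prod_eq_one fun k _ => ?_
  simp [sgn]
  ring

lemma prod_sign_weights_nonneg {ι : Type*} [Fintype ι] {a : ι → ℝ} (ha : ∀ i, |a i| ≤ 1)
    (s : ι → Bool) : 0 ≤ ∏ k, (1 + sgn (s k) * a k) / 2 := by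
  refine Finset.prod_nonneg fun k _ => ?_
  have := neg_abs_le (sgn (s k) * a k)
  rw [abs_mul, abs_sgn, one_mul] at this
  linarith [ha k]

/-- Draw independent signs with means `a j i`. The modes are independent, so the expectation of the
product of signs is the product of the means. -/
lemma prod_mem_convexHull [Nonempty (Fin N)] (a : Fin d → Fin N → ℝ) (ha : ∀ j i, |a j i| ≤ 1) :
    (fun ω => ∏ j, a j (ω j)) ∈ convexHull ℝ (signTensors d N) := by
  set W : (Fin d → Fin N → Bool) → ℝ := fun σ => ∏ j, ∏ k, (1 + sgn (σ j k) * a j k) / 2 with hW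
  have h1 : ∑ σ, W σ = 1 := by
    rw [hW, ← Fintype.prod_sum fun j (s : Fin N → Bool) => ∏ k, (1 + sgn (s k) * a j k) / 2]
    exact Finset.prod_eq_one fun j _ => sum_sign_weights _
  have h0 : ∀ σ, 0 ≤ W σ := fun σ =>
    Finset.prod_nonneg fun j _ => prod_sign_weights_nonneg (ha j) (σ j)
  have h2 : (fun ω : Idx d N => ∏ j, a j (ω j)) = ∑ σ, W σ • signProd σ := by
    ext ω
    simp only [Finset.sum_apply, Pi.smul_apply, smul_eq_mul, hW, signProd,
      ← Finset.prod_mul_distrib]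
    rw [← Fintype.prod_sum fun j (s : Fin N → Bool) =>
      (∏ k, (1 + sgn (s k) * a j k) / 2) * sgn (s (ω j))]
    exact Finset.prod_congr rfl fun j _ => (sum_signs_eq _ _).symm
  rw [h2]
  exact (convex_convexHull ℝ _).sum_mem (fun σ _ => h0 σ) h1
    fun σ _ => subset_convexHull ℝ _ (signProd_mem σ)

/-- A tensor with small entries is the average over its `n` positions of `n` times the single-entry
tensors, each a bounded rank-one tensor. Hence the hull is absorbent and its gauge is continuous. -/
lemma convexHull_signTensors_mem_nhds [Nonempty (Fin N)] :
    convexHull ℝ (signTensors (d + 1) N) ∈ nhds 0 := by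
  classical
  set n : ℝ := (Fintype.card (Idx (d + 1) N) : ℝ) with hn
  have hn0 : 0 < n := by
    rw [hn]
    exact_mod_cast Fintype.card_pos
  refine Filter.mem_of_superset (Metric.closedBall_mem_nhds 0 (inv_pos.2 hn0)) fun X hX => ?_
  rw [mem_closedBall_zero_iff] at hX
  have h1 : X = ∑ ω₀, n⁻¹ • fun ω : Idx (d + 1) N =>
      ∏ j, (if j = 0 then n * X ω₀ else 1) * if ω j = ω₀ j then 1 else 0 := by
    ext ω
    simp only [Finset.sum_apply, Pi.smul_apply, smul_eq_mul, Finset.prod_mul_distrib]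
    rw [Finset.sum_eq_single ω]
    · simp
      field_simp
    · intro ω₀ _ h
      obtain ⟨j, hj⟩ : ∃ j, ω j ≠ ω₀ j := by
        by_contra! h'
        exact h (funext h').symm
      rw [Finset.prod_eq_zero (i := j) (f := fun j => if ω j = ω₀ j then (1 : ℝ) else 0)
        (Finset.mem_univ _) (by simp [hj])]
      simp
    · simp
  rw [h1]
  refine (convex_convexHull ℝ _).sum_mem (fun _ _ => (inv_pos.2 hn0).le) ?_ fun ω₀ _ =>
    prod_mem_convexHull (fun j i => (if j = 0 then n * X ω₀ else 1) * if i = ω₀ j then 1 else 0)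
      fun j i => ?_
  · rw [Finset.sum_const, Finset.card_univ, nsmul_eq_mul, ← hn, mul_inv_cancel₀ hn0.ne']
  · have hX' : |n * X ω₀| ≤ 1 := by
      rw [abs_mul, abs_of_pos hn0]
      calc n * |X ω₀| ≤ n * n⁻¹ :=
            mul_le_mul_of_nonneg_left ((norm_le_pi_norm X ω₀).trans hX) hn0.le
        _ = 1 := mul_inv_cancel₀ hn0.ne'
    split_ifs <;> first | (rw [mul_one]; exact hX') | simp

lemma mNorm_eq_gauge (T : Tensor d N) : mNorm T = gauge (convexHull ℝ (signTensors d N)) T := rfl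

lemma mNorm_le_of_decomposition [Nonempty (Fin N)] {κ : Type*} [Fintype κ] {α : ℝ} (hα : 0 ≤ α)
    {T : Tensor (d + 1) N} (w : κ → Fin (d + 1) → Fin N → ℝ) (hw : ∀ k j n, |w k j n| ≤ 1)
    (hT : ∀ ω, T ω = α * ∑ k, ∏ j, w k j (ω j)) : mNorm T ≤ α * Fintype.card κ := by
  have h1 : T = α • ∑ k, fun ω : Idx (d + 1) N => ∏ j, w k j (ω j) := by
    ext ω
    simp [hT]
  rw [mNorm_eq_gauge, h1, gauge_smul_of_nonneg hα, smul_eq_mul]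
  refine mul_le_mul_of_nonneg_left ?_ hα
  refine (gauge_sum_le (convex_convexHull ℝ _)
    (absorbent_nhds_zero convexHull_signTensors_mem_nhds) _ _).trans ?_
  refine (Finset.sum_le_card_nsmul _ _ 1 fun k _ => ?_).trans (by simp)
  exact gauge_le_one_of_mem (prod_mem_convexHull _ (hw k))

lemma mNorm_le_radiusM {r : ℕ} {α : ℝ} {T : Tensor (d + 1) N} (hr : rank T ≤ r)
    (hT : ‖T‖ ≤ α) : mNorm T ≤ radiusM (d + 1) r α := by
  have hα : 0 ≤ α := (norm_nonneg T).trans hT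
  rcases isEmpty_or_nonempty (Fin N) with hN | hN
  · have : mNorm T ≤ 0 := by
      have hT0 : T = 0 := funext fun ω => (hN.false (ω 0)).elim
      rw [mNorm_eq_gauge, hT0, gauge_zero]
    refine this.trans (mul_nonneg (by positivity) hα)
  · obtain ⟨u, hu⟩ := exists_rank_decomposition' T
    obtain ⟨w, hw, hTw⟩ := exists_bounded_decomposition hα d T u hu
      fun ω => (norm_le_pi_norm T ω).trans hT
    refine (mNorm_le_of_decomposition hα w hw hTw).trans ?_
    rw [radiusM, mul_comm]
    refine mul_le_mul_of_nonneg_right ?_ hα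
    simp only [Fintype.card_pi, Fintype.card_fin, Finset.prod_const, Finset.card_univ,
      Nat.add_sub_cancel]
    push_cast
    refine pow_le_pow_left₀ (by positivity) ?_ d
    have hr' : (rank T : ℝ) ≤ r := by exact_mod_cast hr
    refine hr'.trans ?_
    -- The decomposition has only `r ^ d` terms; the extra factor `√r` is slack.
    rcases Nat.eq_zero_or_pos r with h0 | h0
    · simp [h0]
    · refine le_mul_of_one_le_right (by positivity) (Real.one_le_sqrt.2 ?_)
      exact_mod_cast h0

lemma le_mul_of_forall_gt {S R M : ℝ} (hM : 0 ≤ M) (h : ∀ t, R < t → S ≤ t * M) :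
    S ≤ R * M := by
  rcases hM.eq_or_lt with h0 | h0
  · have := h (R + 1) (by linarith)
    rwa [← h0, mul_zero] at this ⊢
  · rw [← div_le_iff₀ h0]
    refine le_of_forall_gt_imp_ge_of_dense fun t ht => ?_
    rw [div_le_iff₀ h0]
    exact h t ht

/-- The M-norm ball is dominated by the sign tensors. -/
lemma exists_signProd_ge [Nonempty (Fin N)] {R : ℝ} (A X : Tensor (d + 1) N)
    (hX : mNorm X ≤ R) : ∃ σ, ∑ ω, A ω * X ω ≤ R * ∑ ω, A ω * signProd σ ω := by
  obtain ⟨σ, hσ⟩ := Finite.exists_max fun σ : Fin (d + 1) → Fin N → Bool =>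
    ∑ ω, A ω * signProd σ ω
  refine ⟨σ, ?_⟩
  set M := ∑ ω, A ω * signProd σ ω with hM
  -- A linear functional is at most `M` on the hull as soon as it is on the sign tensors.
  have hhull : convexHull ℝ (signTensors (d + 1) N) ⊆ {Y | ∑ ω, A ω * Y ω ≤ M} := by
    refine convexHull_min ?_ ?_
    · intro Y hY
      obtain ⟨τ, rfl⟩ := exists_signProd_eq hY
      exact hσ τ
    · refine convex_halfSpace_le ⟨fun Y Z => ?_, fun c Y => ?_⟩ M
      · simp [mul_add, Finset.sum_add_distrib]
      · simp [Finset.mul_sum, mul_left_comm]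
  have hM0 : 0 ≤ M := by
    have := hhull (mem_of_mem_nhds convexHull_signTensors_mem_nhds)
    simpa using this
  have hlt : ∀ t, R < t → ∑ ω, A ω * X ω ≤ t * M := by
    intro t ht
    have habs := absorbent_nhds_zero (𝕜 := ℝ) (convexHull_signTensors_mem_nhds (d := d) (N := N))
    obtain ⟨b, hb0, hbt, Y, hY, rfl⟩ :=
      exists_lt_of_gauge_lt habs (lt_of_le_of_lt (mNorm_eq_gauge X ▸ hX) ht)
    have h1 : ∑ ω, A ω * (b • Y) ω = b * ∑ ω, A ω * Y ω := by
      simp [Finset.mul_sum, mul_left_comm]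
    simp only [h1]
    exact (mul_le_mul_of_nonneg_left (hhull hY) hb0.le).trans
      (mul_le_mul_of_nonneg_right hbt.le hM0)
  exact le_mul_of_forall_gt hM0 hlt

lemma isClosed_mNorm_le [Nonempty (Fin N)] (R : ℝ) :
    IsClosed {T : Tensor (d + 1) N | mNorm T ≤ R} :=
  isClosed_le (continuous_gauge (convex_convexHull ℝ _) convexHull_signTensors_mem_nhds)
    continuous_const

end MNorm

/-! ### Closedness of the max-qnorm ball -/

section MaxNorm

variable {d N : ℕ}

/-- Factorizations can be balanced. -/
lemma exists_balanced_factorization {T : Tensor (d + 1) N} {s : ℝ} (hs : 0 < s)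
    (hT : maxQNorm T < s ^ (d + 1)) :
    ∃ (k : ℕ) (U : Fin (d + 1) → Fin N → Fin k → ℝ),
      (∀ ω, T ω = ∑ l, ∏ j, U j (ω j) l) ∧ ∀ j i, ∑ l, U j i l ^ 2 ≤ s ^ 2 := by
  obtain ⟨k, U, hU, hlt⟩ := exists_maxQNorm_lt hT
  have hsq := fun j => sum_sq_le_rowNorm_sq (U j)
  have ha0 := fun j => rowNorm_nonneg (U j)
  set a : Fin (d + 1) → ℝ := fun j => rowNorm (U j) with ha
  -- A vanishing factor forces `T = 0`, and the factorization without columns serves.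
  by_cases hz : ∃ j, a j = 0
  · obtain ⟨j, hj⟩ := hz
    refine ⟨0, fun _ _ _ => 0, fun ω => ?_, fun _ _ => by simp; positivity⟩
    have h0 : ∀ l, U j (ω j) l = 0 := by
      intro l
      have h := hsq j (ω j)
      rw [show rowNorm (U j) = 0 from hj, zero_pow two_ne_zero] at h
      have := (Finset.single_le_sum (f := fun l => U j (ω j) l ^ 2) (fun l _ => sq_nonneg _)
        (Finset.mem_univ l)).trans h
      exact pow_eq_zero_iff two_ne_zero |>.1 (le_antisymm this (sq_nonneg _))
    rw [hU, outer]
    simp only [Finset.univ_eq_empty, Finset.sum_empty]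
    exact Finset.sum_eq_zero fun l _ => Finset.prod_eq_zero (Finset.mem_univ j) (h0 l)
  · push Not at hz
    have hpos : ∀ j, 0 < a j := fun j => lt_of_le_of_ne (ha0 j) (hz j).symm
    have hP : 0 < ∏ j, a j := Finset.prod_pos fun j _ => hpos j
    -- Rescaling every factor to row norm `s` changes the product by `s ^ (d + 1) / ∏ a`, which is
    -- at least one; `q` undoes this in the first mode.
    set q : Fin (d + 1) → ℝ := fun j => if j = 0 then (∏ j, a j) / s ^ (d + 1) else 1 with hq
    have hq0 : ∀ j, 0 ≤ q j := by
      intro j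
      simp only [hq]
      split_ifs <;> positivity
    have hq1 : ∀ j, q j ≤ 1 := by
      intro j
      simp only [hq]
      split_ifs
      · exact div_le_one_of_le₀ hlt.le (by positivity)
      · exact le_rfl
    have hqp : ∏ j, q j = (∏ j, a j) / s ^ (d + 1) := by simp [hq]
    refine ⟨k, fun j i l => q j * (s / a j) * U j i l, fun ω => ?_, fun j i => ?_⟩
    · rw [hU, outer]
      refine Finset.sum_congr rfl fun l _ => ?_
      rw [Finset.prod_mul_distrib, Finset.prod_mul_distrib, hqp, Finset.prod_div_distrib,
        Finset.prod_const, Finset.card_univ, Fintype.card_fin]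
      have : (∏ j, a j) / s ^ (d + 1) * (s ^ (d + 1) / ∏ j, a j) = 1 := by
        field_simp
      rw [this, one_mul]
    · simp only [mul_pow, ← Finset.mul_sum, div_pow]
      have h1 : q j ^ 2 ≤ 1 := pow_le_one₀ (hq0 j) (hq1 j)
      have h2 : s ^ 2 / a j ^ 2 * ∑ l, U j i l ^ 2 ≤ s ^ 2 := by
        rw [div_mul_eq_mul_div, div_le_iff₀ (pow_pos (hpos j) 2)]
        exact mul_le_mul_of_nonneg_left (hsq j i) (sq_nonneg s)
      have h3 : 0 ≤ s ^ 2 / a j ^ 2 * ∑ l, U j i l ^ 2 := by positivity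
      rw [mul_assoc]
      exact (mul_le_of_le_one_left h3 h1).trans h2

/-- A perturbation bound for the max-qnorm. -/
lemma maxQNorm_le_of_norm_sub_le {X Z : Tensor (d + 1) N} {s t : ℝ} (hs : 0 < s) (ht : 0 < t)
    (hX : maxQNorm X < s ^ (d + 1)) (hZ : ‖Z - X‖ ≤ t ^ (d + 1)) :
    maxQNorm Z ≤ √(s ^ 2 + Fintype.card (Idx (d + 1) N) * t ^ 2) ^ (d + 1) := by
  classical
  obtain ⟨k, U, hU, hUs⟩ := exists_balanced_factorization hs hX
  have h := maxQNorm_le (T := Z) (ι := Fin k ⊕ Idx (d + 1) N)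
    (B := fun _ => √(s ^ 2 + Fintype.card (Idx (d + 1) N) * t ^ 2))
    -- One extra column per position carries that entry of `Z - X`. All modes but the first
    -- contribute `t`, so the first contributes the entry over `t ^ d`, again at most `t`.
    (fun j i => Sum.elim (U j i) fun ω₀ =>
      (if j = 0 then (Z ω₀ - X ω₀) / t ^ d else t) * if i = ω₀ j then 1 else 0)
    (fun ω => by
      rw [Fintype.sum_sum_type]
      simp only [Sum.elim_inl, Sum.elim_inr]
      rw [← hU ω, Finset.sum_eq_single ω]
      · simp [Fin.prod_univ_succ, Fin.succ_ne_zero]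
        field_simp
        ring
      · intro ω₀ _ h
        obtain ⟨j, hj⟩ : ∃ j, ω j ≠ ω₀ j := by
          by_contra! h'
          exact h (funext h').symm
        exact Finset.prod_eq_zero (Finset.mem_univ j) (by simp [hj])
      · simp)
    (fun _ => Real.sqrt_nonneg _)
    (fun j i => by
      rw [Real.sq_sqrt (by positivity), Fintype.sum_sum_type]
      simp only [Sum.elim_inl, Sum.elim_inr]
      refine add_le_add (hUs j i) ?_
      refine (Finset.sum_le_card_nsmul _ _ (t ^ 2) fun ω₀ _ => ?_).trans (by simp)
      have h1 : |if j = 0 then (Z ω₀ - X ω₀) / t ^ d else t| ≤ t := by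
        split_ifs
        · rw [abs_div, abs_of_pos (pow_pos ht d), div_le_iff₀ (pow_pos ht d), ← pow_succ']
          exact (norm_le_pi_norm (Z - X) ω₀).trans hZ
        · exact (abs_of_pos ht).le
      rw [← sq_abs]
      refine pow_le_pow_left₀ (abs_nonneg _) ?_ 2
      rw [abs_mul]
      refine (mul_le_of_le_one_right (abs_nonneg _) ?_).trans h1
      split_ifs <;> simp)
  simpa using h

lemma exists_pow_eq {x : ℝ} (hx : 0 < x) (d : ℕ) : ∃ s, 0 < s ∧ s ^ (d + 1) = x :=
  ⟨x ^ ((↑(d + 1) : ℝ)⁻¹), Real.rpow_pos_of_pos hx _, Real.rpow_inv_natCast_pow hx.le (by simp)⟩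

/-- The perturbation bound stands in for a triangle inequality: it tends to `x` as `t → 0`, for
every `x > R`. -/
lemma isClosed_maxQNorm_le (R : ℝ) : IsClosed {T : Tensor (d + 1) N | maxQNorm T ≤ R} := by
  refine isClosed_of_closure_subset fun Z hZ => ?_
  rw [Metric.mem_closure_iff] at hZ
  have hR : 0 ≤ R := by
    obtain ⟨X, hX, -⟩ := hZ 1 one_pos
    exact (maxQNorm_nonneg X).trans hX
  refine le_of_forall_gt_imp_ge_of_dense (α := ℝ) fun x hx => ?_
  obtain ⟨s, hs, hsx⟩ := exists_pow_eq (hR.trans_lt hx) d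
  have hlim : Filter.Tendsto
      (fun t : ℝ => √(s ^ 2 + Fintype.card (Idx (d + 1) N) * t ^ 2) ^ (d + 1))
      (nhdsWithin 0 (Set.Ioi 0)) (nhds x) := by
    have hc : Continuous fun t : ℝ =>
        √(s ^ 2 + Fintype.card (Idx (d + 1) N) * t ^ 2) ^ (d + 1) := by fun_prop
    have := hc.tendsto 0
    simp only [ne_eq, OfNat.ofNat_ne_zero, not_false_eq_true, zero_pow, mul_zero, add_zero,
      Real.sqrt_sq hs.le, hsx] at this
    exact this.mono_left nhdsWithin_le_nhds
  refine ge_of_tendsto hlim ?_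
  filter_upwards [self_mem_nhdsWithin] with t ht
  obtain ⟨X, hX, hd⟩ := hZ (t ^ (d + 1)) (pow_pos ht _)
  refine maxQNorm_le_of_norm_sub_le hs ht (hsx ▸ lt_of_le_of_lt hX hx) ?_
  rw [← dist_eq_norm]
  exact hd.le

end MaxNorm

/-! ### Existence of minimizers -/

section Existence

variable {d N m : ℕ} {f : ℝ → ℝ} {α : ℝ}

lemma exists_isEstimator (hf : IsLink f α) (s : Fin m → Idx d N × Bool)
    {F : Set (Tensor d N)} (hF : IsClosed F) (hne : {T | ‖T‖ ≤ α ∧ T ∈ F}.Nonempty) :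
    ∃ X, IsEstimator f s {T | ‖T‖ ≤ α ∧ T ∈ F} X := by
  have hcl : IsClosed {T : Tensor d N | ‖T‖ ≤ α ∧ T ∈ F} :=
    (isClosed_le continuous_norm continuous_const).inter hF
  have hK : IsCompact {T : Tensor d N | ‖T‖ ≤ α ∧ T ∈ F} :=
    (isCompact_closedBall (0 : Tensor d N) α).of_isClosed_subset hcl fun T hT => by
      simpa using hT.1
  have hcont : ContinuousOn (negLogLik f s) {T : Tensor d N | ‖T‖ ≤ α ∧ T ∈ F} := by
    refine continuousOn_finsetSum _ fun t _ X hX => ?_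
    have h := (hf.hasDerivAt_loss (abs_apply_le_of_norm_le hX.1 (s t).1) (s t).2).continuousAt
    exact (ContinuousAt.comp (f := fun X : Tensor d N => X (s t).1) h
      (continuous_apply (s t).1).continuousAt).continuousWithinAt
  obtain ⟨X, hX, hmin⟩ := hK.exists_isMinOn hne hcont
  exact ⟨X, hX, fun Y hY => hmin hY⟩

end Existence

/-! ### Moments of Rademacher sums -/

section Rademacher

variable {k : ℕ}

/-- The Rademacher sum with coefficients `x`. -/
def radSum (x : Fin k → ℝ) (ε : Fin k → Bool) : ℝ := ∑ l, sgn (ε l) * x l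

lemma radSum_cons (x : Fin (k + 1) → ℝ) (b : Bool) (ε : Fin k → Bool) :
    radSum x (Fin.cons b ε) = sgn b * x 0 + radSum (fun l => x l.succ) ε := by
  simp [radSum, Fin.sum_univ_succ]

lemma prodExp_coin_succ (F : (Fin (k + 1) → Bool) → ℝ) :
    prodExp coin F = prodExp coin fun ε => (F (Fin.cons true ε) + F (Fin.cons false ε)) / 2 := by
  rw [prodExp_succ, Fintype.sum_bool, ← prodExp_const_mul, ← prodExp_const_mul, ← prodExp_add]
  congr 1
  ext ε
  simp only [coin]
  ring

lemma prodExp_radSum_mul (x y : Fin k → ℝ) :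
    prodExp coin (fun ε => radSum x ε * radSum y ε) = ∑ l, x l * y l := by
  induction k with
  | zero => simp [prodExp_zero, radSum]
  | succ k ih =>
    rw [prodExp_coin_succ, Fin.sum_univ_succ, ← ih]
    conv_rhs => rw [← prodExp_const (m := k) sum_coin (x 0 * y 0), ← prodExp_add]
    congr 1
    ext ε
    simp only [radSum_cons, sgn, if_true, Bool.false_eq_true, if_false]
    ring

/-- One more sign adds `x₀⁴ + 6 x₀² ∑ x²`, and `3 (x₀² + s)²` leaves room for exactly this cross
term. -/
lemma prodExp_radSum_pow_four_le (x : Fin k → ℝ) :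
    prodExp coin (fun ε => radSum x ε ^ 4) ≤ 3 * (∑ l, x l ^ 2) ^ 2 := by
  induction k with
  | zero => simp [prodExp_zero, radSum]
  | succ k ih =>
    have h2 := prodExp_radSum_mul (fun l => x (Fin.succ l)) (fun l => x (Fin.succ l))
    have h4 := ih fun l => x l.succ
    rw [prodExp_coin_succ, Fin.sum_univ_succ]
    have e : (prodExp coin fun ε : Fin k → Bool =>
        (radSum x (Fin.cons true ε) ^ 4 + radSum x (Fin.cons false ε) ^ 4) / 2) =
        x 0 ^ 4 + (6 * x 0 ^ 2 * ∑ l : Fin k, x l.succ * x l.succ +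
          prodExp coin fun ε => radSum (fun l => x (Fin.succ l)) ε ^ 4) := by
      rw [← h2, ← prodExp_const_mul, ← prodExp_add]
      conv_rhs => rw [← prodExp_const (m := k) sum_coin (x 0 ^ 4), ← prodExp_add]
      congr 1
      ext ε
      simp only [radSum_cons, sgn, if_true, Bool.false_eq_true, if_false]
      ring
    rw [e]
    simp only [← sq]
    nlinarith [sq_nonneg (x 0 ^ 2)]

end Rademacher

/-! ### The bilinear Grothendieck inequality -/

section Grothendieck

/-- Truncation at level `2`. -/
def clip (x : ℝ) : ℝ := max (-2) (min 2 x)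

lemma abs_clip_div_two_le (x : ℝ) : |clip x / 2| ≤ 1 := by
  have h1 : -2 ≤ clip x := le_max_left _ _
  have h2 : clip x ≤ 2 := max_le (by norm_num) (min_le_left _ _)
  rw [abs_le]
  constructor <;> linarith

lemma clip_cases (x : ℝ) : clip x = x ∨ (2 < x ∧ clip x = 2) ∨ (x < -2 ∧ clip x = -2) := by
  unfold clip
  rcases lt_or_ge 2 x with h | h
  · right; left
    exact ⟨h, by rw [min_eq_left h.le]; norm_num⟩
  · rw [min_eq_right h]
    rcases lt_or_ge x (-2) with h' | h'
    · right; right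
      exact ⟨h', max_eq_left h'.le⟩
    · left
      exact max_eq_right h'

lemma clip_sq_le (x : ℝ) : clip x ^ 2 ≤ x ^ 2 := by
  rcases clip_cases x with h | ⟨h, h'⟩ | ⟨h, h'⟩
  · rw [h]
  · rw [h']; nlinarith
  · rw [h']; nlinarith

/-- With the fourth-moment bound, the truncation error times `4` still has second moment at most
`3/4`, so it is again an admissible vector. -/
lemma sq_sub_clip_le (x : ℝ) : (4 * (x - clip x)) ^ 2 ≤ x ^ 4 / 4 := by
  have h : |4 * (x - clip x)| ≤ x ^ 2 / 2 := by
    rcases clip_cases x with h | ⟨h, h'⟩ | ⟨h, h'⟩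
    · rw [h, sub_self, mul_zero, abs_zero]; positivity
    · rw [h', abs_of_pos (by linarith)]; nlinarith [sq_nonneg (x - 4)]
    · rw [h', abs_of_neg (by linarith)]; nlinarith [sq_nonneg (x + 4)]
  have := sq_le_sq' (neg_le_of_abs_le h) (le_of_abs_le h)
  linarith

variable {I J : Type*} [Fintype I] [Fintype J]

/-- The bilinear form with matrix `B`. -/
def bilin (B : I → J → ℝ) (a : I → ℝ) (b : J → ℝ) : ℝ := ∑ i, ∑ j, B i j * (a i * b j)

lemma bilin_mul_mul (B : I → J → ℝ) (a : I → ℝ) (b : J → ℝ) (s t : ℝ) :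
    bilin B (fun i => s * a i) (fun j => t * b j) = s * t * bilin B a b := by
  simp only [bilin, Finset.mul_sum]
  exact Finset.sum_congr rfl fun i _ => Finset.sum_congr rfl fun j _ => by ring

/-- Vectors in the cube are averages of independent random sign vectors, and the form is bilinear.
-/
lemma bilin_le_of_abs_le_one [DecidableEq I] [DecidableEq J] {B : I → J → ℝ} {G : ℝ}
    (hG : ∀ (s : I → Bool) (t : J → Bool), bilin B (fun i => sgn (s i)) (fun j => sgn (t j)) ≤ G)
    {a : I → ℝ} {b : J → ℝ} (ha : ∀ i, |a i| ≤ 1) (hb : ∀ j, |b j| ≤ 1) : bilin B a b ≤ G := by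
  have h1 : bilin B a b = ∑ s : I → Bool, (∏ k, (1 + sgn (s k) * a k) / 2) *
      ∑ t : J → Bool, (∏ k, (1 + sgn (t k) * b k) / 2) *
        bilin B (fun i => sgn (s i)) (fun j => sgn (t j)) := by
    have h2 : ∀ i j, B i j * (a i * b j) = ∑ s : I → Bool, ∑ t : J → Bool,
        (∏ k, (1 + sgn (s k) * a k) / 2) * ((∏ k, (1 + sgn (t k) * b k) / 2) *
          (B i j * (sgn (s i) * sgn (t j)))) := by
      intro i j
      conv_lhs => rw [← sum_signs_eq a i, ← sum_signs_eq b j]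
      rw [Finset.sum_mul_sum, Finset.mul_sum]
      refine Finset.sum_congr rfl fun s _ => ?_
      rw [Finset.mul_sum]
      exact Finset.sum_congr rfl fun t _ => by ring
    simp only [bilin, h2, Finset.mul_sum]
    rw [Finset.sum_congr rfl fun i _ => Finset.sum_comm, Finset.sum_comm]
    refine Finset.sum_congr rfl fun s _ => ?_
    rw [Finset.sum_congr rfl fun i _ => Finset.sum_comm, Finset.sum_comm]
  rw [h1]
  calc _ ≤ ∑ s : I → Bool, (∏ k, (1 + sgn (s k) * a k) / 2) *
      ∑ t : J → Bool, (∏ k, (1 + sgn (t k) * b k) / 2) * G :=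
        Finset.sum_le_sum fun s _ => mul_le_mul_of_nonneg_left (Finset.sum_le_sum fun t _ =>
          mul_le_mul_of_nonneg_left (hG s t) (prod_sign_weights_nonneg hb t))
          (prod_sign_weights_nonneg ha s)
    _ = G := by simp only [← Finset.sum_mul, sum_sign_weights, one_mul]

/-- Grothendieck's inequality, with a non-optimal constant. -/
lemma grothendieck [DecidableEq I] [DecidableEq J] {B : I → J → ℝ} {G : ℝ}
    (hG : ∀ (s : I → Bool) (t : J → Bool), bilin B (fun i => sgn (s i)) (fun j => sgn (t j)) ≤ G)
    {k : ℕ} (x : I → Fin k → ℝ) (y : J → Fin k → ℝ) (hx : ∀ i, ∑ l, x i l ^ 2 ≤ 1)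
    (hy : ∀ j, ∑ l, y j l ^ 2 ≤ 1) : ∑ l, bilin B (x · l) (y · l) ≤ 8 * G := by
  have hG0 : 0 ≤ G := by
    simpa [bilin] using bilin_le_of_abs_le_one hG (a := fun _ => 0) (b := fun _ => 0)
      (by simp) (by simp)
  set S₀ := ∑ i, ∑ j, |B i j| with hS₀
  -- The bound improves itself: truncated Rademacher sums cost `4 G`, and the two error terms, with
  -- weight `1/4` each, satisfy the previous bound. So `8 G + ε` becomes `4 G + (8 G + ε) / 2 = 8 G
  -- + ε / 2`.
  have claim : ∀ (n k : ℕ) (x : I → Fin k → ℝ) (y : J → Fin k → ℝ), (∀ i, ∑ l, x i l ^ 2 ≤ 1) →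
      (∀ j, ∑ l, y j l ^ 2 ≤ 1) → ∑ l, bilin B (x · l) (y · l) ≤ 8 * G + (1 / 2) ^ n * S₀ := by
    intro n
    induction n with
    | zero =>
      intro k x y hx hy
      rw [pow_zero, one_mul]
      refine le_add_of_nonneg_of_le (by positivity) ?_
      simp only [bilin]
      rw [Finset.sum_comm]
      refine Finset.sum_le_sum fun i _ => ?_
      rw [Finset.sum_comm]
      refine Finset.sum_le_sum fun j _ => ?_
      rw [← Finset.mul_sum]
      refine (le_abs_self _).trans ?_
      rw [abs_mul]
      refine mul_le_of_le_one_right (abs_nonneg _) ?_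
      rw [← sq_le_one_iff_abs_le_one]
      exact (Finset.sum_mul_sq_le_sq_mul_sq _ _ _).trans
        (mul_le_one₀ (hx i) (Finset.sum_nonneg fun _ _ => sq_nonneg _) (hy j))
    | succ n ih =>
      intro k x y hx hy
      -- Functions on the sign cube are vectors in dimension `2 ^ k` after weighting by square roots
      -- of probabilities; hence `k` varies in the induction.
      have hgen : ∀ (X : I → (Fin k → Bool) → ℝ) (Y : J → (Fin k → Bool) → ℝ),
          (∀ i, prodExp coin (fun ε => X i ε ^ 2) ≤ 1) →
          (∀ j, prodExp coin (fun ε => Y j ε ^ 2) ≤ 1) →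
          prodExp coin (fun ε => bilin B (X · ε) (Y · ε)) ≤ 8 * G + (1 / 2) ^ n * S₀ := by
        intro X Y hX hY
        let e := Fintype.equivFin (Fin k → Bool)
        have hc : ∀ ε : Fin k → Bool, 0 ≤ ∏ t, coin (ε t) := fun ε =>
          Finset.prod_nonneg fun t _ => coin_nonneg _
        have hsq : ∀ Z : (Fin k → Bool) → ℝ,
            ∑ l, (√(∏ t, coin (e.symm l t)) * Z (e.symm l)) ^ 2 =
              prodExp coin fun ε => Z ε ^ 2 := by
          intro Z
          rw [prodExp, ← e.symm.sum_comp]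
          exact Finset.sum_congr rfl fun l _ => by rw [mul_pow, Real.sq_sqrt (hc _)]
        have := ih _ (fun i l => √(∏ t, coin (e.symm l t)) * X i (e.symm l))
          (fun j l => √(∏ t, coin (e.symm l t)) * Y j (e.symm l))
          (fun i => by rw [hsq]; exact hX i) (fun j => by rw [hsq]; exact hY j)
        refine le_trans (le_of_eq ?_) this
        rw [prodExp, ← e.symm.sum_comp]
        refine Finset.sum_congr rfl fun l _ => ?_
        rw [bilin_mul_mul, Real.mul_self_sqrt (hc _)]
      have e1 : ∑ l, bilin B (x · l) (y · l) =
          prodExp coin fun ε => bilin B (fun i => radSum (x i) ε) (fun j => radSum (y j) ε) := by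
        simp only [bilin, prodExp_sum, prodExp_const_mul, prodExp_radSum_mul, Finset.mul_sum]
        rw [Finset.sum_comm]
        exact Finset.sum_congr rfl fun i _ => Finset.sum_comm
      have e2 : ∀ ε : Fin k → Bool,
          bilin B (fun i => radSum (x i) ε) (fun j => radSum (y j) ε) =
          4 * bilin B (fun i => clip (radSum (x i) ε) / 2) (fun j => clip (radSum (y j) ε) / 2) +
          (1 / 4 * bilin B (fun i => 4 * (radSum (x i) ε - clip (radSum (x i) ε)))
            (fun j => clip (radSum (y j) ε)) +
          1 / 4 * bilin B (fun i => radSum (x i) ε)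
            (fun j => 4 * (radSum (y j) ε - clip (radSum (y j) ε)))) := by
        intro ε
        simp only [bilin, Finset.mul_sum, ← Finset.sum_add_distrib]
        exact Finset.sum_congr rfl fun i _ => Finset.sum_congr rfl fun j _ => by ring
      have hF : ∀ z : Fin k → ℝ, ∑ l, z l ^ 2 ≤ 1 →
          prodExp coin (fun ε => radSum z ε ^ 2) ≤ 1 := by
        intro z hz
        have := prodExp_radSum_mul z z
        simp only [← sq] at this
        rwa [this]
      have hT : ∀ z : Fin k → ℝ, ∑ l, z l ^ 2 ≤ 1 →
          prodExp coin (fun ε => clip (radSum z ε) ^ 2) ≤ 1 := fun z hz =>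
        (prodExp_mono coin_nonneg fun ε => clip_sq_le _).trans (hF z hz)
      have hR : ∀ z : Fin k → ℝ, ∑ l, z l ^ 2 ≤ 1 →
          prodExp coin (fun ε => (4 * (radSum z ε - clip (radSum z ε))) ^ 2) ≤ 1 := by
        intro z hz
        refine (prodExp_mono coin_nonneg fun ε => (sq_sub_clip_le (radSum z ε)).trans
          (le_of_eq (by ring : _ = 1 / 4 * radSum z ε ^ 4))).trans ?_
        rw [prodExp_const_mul]
        have h1 := prodExp_radSum_pow_four_le z
        have h2 : (∑ l, z l ^ 2) ^ 2 ≤ 1 :=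
          pow_le_one₀ (Finset.sum_nonneg fun _ _ => sq_nonneg _) hz
        linarith
      rw [e1]
      simp only [e2]
      rw [prodExp_add, prodExp_add, prodExp_const_mul, prodExp_const_mul, prodExp_const_mul]
      have h1 : prodExp coin (fun ε : Fin k → Bool => bilin B (fun i => clip (radSum (x i) ε) / 2)
          (fun j => clip (radSum (y j) ε) / 2)) ≤ G := by
        rw [← prodExp_const (m := k) sum_coin G]
        exact prodExp_mono coin_nonneg fun ε => bilin_le_of_abs_le_one hG
          (fun i => abs_clip_div_two_le _) fun j => abs_clip_div_two_le _
      have h2 := hgen (fun i ε => 4 * (radSum (x i) ε - clip (radSum (x i) ε)))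
        (fun j ε => clip (radSum (y j) ε)) (fun i => hR _ (hx i)) (fun j => hT _ (hy j))
      have h3 := hgen (fun i ε => radSum (x i) ε)
        (fun j ε => 4 * (radSum (y j) ε - clip (radSum (y j) ε))) (fun i => hF _ (hx i))
        (fun j => hR _ (hy j))
      rw [pow_succ]
      linarith
  have hlim : Filter.Tendsto (fun n : ℕ => 8 * G + (1 / 2 : ℝ) ^ n * S₀) Filter.atTop
      (nhds (8 * G + 0 * S₀)) :=
    ((tendsto_pow_atTop_nhds_zero_of_lt_one (by norm_num) (by norm_num)).mul_const S₀).const_add _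
  rw [zero_mul, add_zero] at hlim
  exact ge_of_tendsto' hlim fun n => claim n k x y hx hy

end Grothendieck

/-! ### Random quaternion units and their Khinchine inequality -/

section Quaternion

open scoped Quaternion

/-- The eight quaternions `±1, ±i, ±j, ±k`. -/
def unitQuat (a : Fin 4 × Bool) : ℍ[ℝ] :=
  ⟨if a.1 = 0 then sgn a.2 else 0, if a.1 = 1 then sgn a.2 else 0,
    if a.1 = 2 then sgn a.2 else 0, if a.1 = 3 then sgn a.2 else 0⟩

lemma unitQuat_re (a : Fin 4 × Bool) : (unitQuat a).re = if a.1 = 0 then sgn a.2 else 0 := rfl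

lemma unitQuat_imI (a : Fin 4 × Bool) : (unitQuat a).imI = if a.1 = 1 then sgn a.2 else 0 := rfl

lemma unitQuat_imJ (a : Fin 4 × Bool) : (unitQuat a).imJ = if a.1 = 2 then sgn a.2 else 0 := rfl

lemma unitQuat_imK (a : Fin 4 × Bool) : (unitQuat a).imK = if a.1 = 3 then sgn a.2 else 0 := rfl

/-- The uniform weights on `±1, ±i, ±j, ±k`. -/
def die (_ : Fin 4 × Bool) : ℝ := 1 / 8

lemma die_nonneg (a : Fin 4 × Bool) : 0 ≤ die a := by norm_num [die]

lemma sum_die : ∑ a, die a = 1 := by simp [die]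

lemma norm_sq_quat (q : ℍ[ℝ]) : ‖q‖ ^ 2 = q.re ^ 2 + q.imI ^ 2 + q.imJ ^ 2 + q.imK ^ 2 := by
  rw [sq, ← Quaternion.normSq_eq_norm_mul_self, Quaternion.normSq_def']

lemma abs_re_le_norm_quat (q : ℍ[ℝ]) : |q.re| ≤ ‖q‖ := by
  refine abs_le_of_sq_le_sq ?_ (norm_nonneg q)
  rw [norm_sq_quat]
  nlinarith [sq_nonneg q.imI, sq_nonneg q.imJ, sq_nonneg q.imK]

lemma norm_unitQuat (a : Fin 4 × Bool) : ‖unitQuat a‖ = 1 := by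
  have : ‖unitQuat a‖ ^ 2 = 1 := by
    rw [norm_sq_quat]
    obtain ⟨c, b⟩ := a
    fin_cases c <;> cases b <;> simp [unitQuat, sgn]
  exact (pow_eq_one_iff_of_nonneg (norm_nonneg _) two_ne_zero).1 this

/-- The inner product of `S` with the `c`-th unit multiple of `a`. -/
lemma norm_add_unitQuat_mul_sq (S a : ℍ[ℝ]) (x : Fin 4 × Bool) :
    ‖unitQuat x * a + S‖ ^ 2 = ‖S‖ ^ 2 + ‖a‖ ^ 2 + sgn x.2 * (2 *
      (![S.re * a.re + S.imI * a.imI + S.imJ * a.imJ + S.imK * a.imK,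
        S.imI * a.re - S.re * a.imI + S.imK * a.imJ - S.imJ * a.imK,
        S.imJ * a.re - S.imK * a.imI - S.re * a.imJ + S.imI * a.imK,
        S.imK * a.re + S.imJ * a.imI - S.imI * a.imJ - S.re * a.imK] : Fin 4 → ℝ) x.1) := by
  simp only [norm_sq_quat]
  obtain ⟨c, b⟩ := x
  fin_cases c <;> cases b <;>
    simp [unitQuat_re, unitQuat_imI, unitQuat_imJ, unitQuat_imK, sgn] <;> ring

lemma sum_die_norm_sq (S a : ℍ[ℝ]) :
    ∑ x, die x * ‖unitQuat x * a + S‖ ^ 2 = ‖S‖ ^ 2 + ‖a‖ ^ 2 := by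
  simp only [norm_add_unitQuat_mul_sq, Fintype.sum_prod_type, Fintype.sum_bool, die, sgn, if_true,
    Bool.false_eq_true, if_false, Fin.sum_univ_four]
  ring

/-- The four inner products of `S` with the unit multiples of `a` have squares summing to `‖S‖²
‖a‖²`, so the cross term has coefficient `3`, against `6` for real signs. -/
lemma sum_die_norm_pow_four (S a : ℍ[ℝ]) :
    ∑ x, die x * ‖unitQuat x * a + S‖ ^ 4 =
      ‖S‖ ^ 4 + (3 * ‖a‖ ^ 2 * ‖S‖ ^ 2 + ‖a‖ ^ 4) := by
  have h4 : ∀ q : ℍ[ℝ], ‖q‖ ^ 4 = (‖q‖ ^ 2) ^ 2 := fun q => by ring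
  have key : ‖S‖ ^ 2 * ‖a‖ ^ 2 =
      (S.re * a.re + S.imI * a.imI + S.imJ * a.imJ + S.imK * a.imK) ^ 2 +
      (S.imI * a.re - S.re * a.imI + S.imK * a.imJ - S.imJ * a.imK) ^ 2 +
      (S.imJ * a.re - S.imK * a.imI - S.re * a.imJ + S.imI * a.imK) ^ 2 +
      (S.imK * a.re + S.imJ * a.imI - S.imI * a.imJ - S.re * a.imK) ^ 2 := by
    rw [norm_sq_quat, norm_sq_quat]
    ring
  simp only [h4, norm_add_unitQuat_mul_sq, Fintype.sum_prod_type, Fintype.sum_bool, die, sgn,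
    if_true, Bool.false_eq_true, if_false, Fin.sum_univ_four, Matrix.cons_val]
  linear_combination -key

variable {k : ℕ}

lemma prodExp_die_norm_sq (Q : Fin k → ℍ[ℝ]) :
    prodExp die (fun ξ => ‖∑ l, unitQuat (ξ l) * Q l‖ ^ 2) = ∑ l, ‖Q l‖ ^ 2 := by
  induction k with
  | zero => simp [prodExp_zero]
  | succ k ih =>
    rw [prodExp_succ]
    simp only [Fin.sum_univ_succ, Fin.cons_zero, Fin.cons_succ]
    simp only [← prodExp_const_mul, ← prodExp_sum, sum_die_norm_sq]
    rw [prodExp_add, ih, prodExp_const sum_die, add_comm]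

lemma prodExp_die_norm_pow_four_le (Q : Fin k → ℍ[ℝ]) :
    prodExp die (fun ξ => ‖∑ l, unitQuat (ξ l) * Q l‖ ^ 4) ≤ 3 / 2 * (∑ l, ‖Q l‖ ^ 2) ^ 2 := by
  induction k with
  | zero => simp [prodExp_zero]
  | succ k ih =>
    rw [prodExp_succ]
    simp only [Fin.sum_univ_succ, Fin.cons_zero, Fin.cons_succ]
    simp only [← prodExp_const_mul, ← prodExp_sum, sum_die_norm_pow_four]
    rw [prodExp_add, prodExp_add, prodExp_const_mul, prodExp_die_norm_sq, prodExp_const sum_die]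
    have := ih fun l => Q l.succ
    nlinarith [sq_nonneg (‖Q 0‖ ^ 2)]

/-- The Khinchine inequality for random quaternion units. -/
lemma sqrt_sum_norm_sq_le (Q : Fin k → ℍ[ℝ]) :
    √(∑ l, ‖Q l‖ ^ 2) ≤ √(3 / 2) * prodExp die fun ξ => ‖∑ l, unitQuat (ξ l) * Q l‖ := by
  set s := ∑ l, ‖Q l‖ ^ 2 with hs
  have hs0 : 0 ≤ s := Finset.sum_nonneg fun _ _ => sq_nonneg _
  rcases hs0.eq_or_lt with h | h
  · rw [← h, Real.sqrt_zero]
    refine mul_nonneg (Real.sqrt_nonneg _) ?_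
    rw [← prodExp_const (m := k) sum_die 0]
    exact prodExp_mono die_nonneg fun ξ => norm_nonneg _
  set v := √(3 / 2) * √s with hv
  have hs' := Real.sqrt_pos.2 h
  have hv0 : 0 < v := by positivity
  have hv2 : v ^ 2 = 3 / 2 * s := by
    rw [hv, mul_pow, Real.sq_sqrt (by norm_num), Real.sq_sqrt hs0]
  -- This is `t (t - v)² (t + 2 v) ≥ 0`. It bounds the first moment below by the second and fourth
  -- ones, with `v` at the scale given by their ratio.
  have hpt : ∀ t : ℝ, 0 ≤ t → 3 / 2 * v ^ 2 * t ^ 2 - 1 / 2 * t ^ 4 ≤ v ^ 3 * t := by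
    intro t ht
    nlinarith [mul_nonneg ht (mul_nonneg (sq_nonneg (t - v)) (by positivity : 0 ≤ t + 2 * v))]
  have h1 : 3 / 2 * v ^ 2 * s - 1 / 2 * (3 / 2 * s ^ 2) ≤
      v ^ 3 * prodExp die fun ξ => ‖∑ l, unitQuat (ξ l) * Q l‖ := by
    rw [← prodExp_const_mul]
    refine le_trans ?_ (prodExp_mono die_nonneg fun ξ => hpt _ (norm_nonneg _))
    rw [prodExp_sub, prodExp_const_mul, prodExp_const_mul, prodExp_die_norm_sq]
    linarith [prodExp_die_norm_pow_four_le Q]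
  set E := prodExp die fun ξ => ‖∑ l, unitQuat (ξ l) * Q l‖
  have h2 : 3 / 2 * s * s ≤ 3 / 2 * s * (v * E) := by
    have : v ^ 3 * E = v ^ 2 * (v * E) := by ring
    rw [this, hv2] at h1
    linarith
  have h3 : s ≤ v * E := le_of_mul_le_mul_left h2 (by positivity)
  have h4 : √s * √s ≤ √s * (√(3 / 2) * E) := by
    rw [Real.mul_self_sqrt hs0]
    refine h3.trans (le_of_eq ?_)
    rw [hv]
    ring
  exact le_of_mul_le_mul_left h4 hs'

/-- A finite set of quaternions in the unit ball that norms all quaternions up to a factor. -/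
lemma exists_norming_set : ∃ t : Finset ℍ[ℝ], (∀ p ∈ t, ‖p‖ ≤ 1) ∧ (∀ x, unitQuat x ∈ t) ∧
    ∀ q : ℍ[ℝ], ∃ p ∈ t, 9 / 10 * ‖q‖ ≤ (q * p).re := by
  classical
  have : ProperSpace ℍ[ℝ] := FiniteDimensional.proper ℝ _
  -- A net of mesh `1/10` in the unit sphere; near the optimal multiplier `star q / ‖q‖` it loses at
  -- most a tenth of the norm.
  obtain ⟨t, ht, htf, hcov⟩ := (isCompact_sphere (0 : ℍ[ℝ]) 1).finite_cover_balls
    (e := 1 / 10) (by norm_num)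
  refine ⟨htf.toFinset ∪ Finset.univ.image unitQuat, fun p hp => ?_, fun x => ?_, fun q => ?_⟩
  · rw [Finset.mem_union, Set.Finite.mem_toFinset, Finset.mem_image] at hp
    rcases hp with hp | ⟨x, -, rfl⟩
    · exact (mem_sphere_zero_iff_norm.1 (ht hp)).le
    · exact (norm_unitQuat x).le
  · exact Finset.mem_union_right _ (Finset.mem_image_of_mem _ (Finset.mem_univ _))
  · rcases eq_or_ne q 0 with rfl | hq
    · exact ⟨unitQuat 0, Finset.mem_union_right _ (Finset.mem_image_of_mem _ (Finset.mem_univ _)),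
        by simp⟩
    · have hq' : 0 < ‖q‖ := norm_pos_iff.2 hq
      set u : ℍ[ℝ] := ‖q‖⁻¹ • star q with hu
      have hu1 : u ∈ Metric.sphere (0 : ℍ[ℝ]) 1 := by
        rw [mem_sphere_zero_iff_norm, hu, norm_smul, norm_star, norm_inv, norm_norm,
          inv_mul_cancel₀ hq'.ne']
      obtain ⟨p, hp, hup⟩ := Set.mem_iUnion₂.1 (hcov hu1)
      refine ⟨p, Finset.mem_union_left _ (htf.mem_toFinset.2 hp), ?_⟩
      have h1 : (q * u).re = ‖q‖ := by
        rw [hu, mul_smul_comm, Quaternion.re_smul, ← Quaternion.inner_def,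
          real_inner_self_eq_norm_sq, smul_eq_mul]
        field_simp
      have h2 : (q * (u - p)).re ≤ ‖q‖ * (1 / 10) := by
        refine (le_abs_self _).trans ((abs_re_le_norm_quat _).trans ?_)
        rw [norm_mul]
        refine mul_le_mul_of_nonneg_left ?_ hq'.le
        rw [← dist_eq_norm]
        exact (Metric.mem_ball.1 hup).le
      rw [mul_sub, Quaternion.re_sub, h1] at h2
      linarith

end Quaternion

/-! ### The multilinear Grothendieck inequality over quaternions -/

section Tonge

open scoped Quaternion

variable {N k : ℕ} {t : Finset ℍ[ℝ]}

lemma re_unitQuat_mul_mul (c : Fin 4) (b b' : Bool) (q : ℍ[ℝ]) :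
    (unitQuat (c, b) * q * unitQuat (0, b')).re =
      sgn b * sgn b' * (unitQuat (c, true) * q).re := by
  fin_cases c <;> cases b <;> cases b' <;>
    simp [unitQuat_re, unitQuat_imI, unitQuat_imJ, unitQuat_imK, sgn]

lemma re_sum_quat {ι : Type*} (s : Finset ι) (q : ι → ℍ[ℝ]) :
    (∑ i ∈ s, q i).re = ∑ i ∈ s, (q i).re := by
  classical
  induction s using Finset.induction_on with
  | empty => simp
  | insert a s ha ih => rw [Finset.sum_insert ha, Finset.sum_insert ha, Quaternion.re_add, ih]

/-- The real components of a quaternion. -/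
def comp (c : Fin 4) (q : ℍ[ℝ]) : ℝ := ![q.re, q.imI, q.imJ, q.imK] c

lemma re_mul_eq_sum_comp (p q : ℍ[ℝ]) :
    (p * q).re = ∑ c, comp c p * (unitQuat (c, true) * q).re := by
  simp [Fin.sum_univ_four, comp, unitQuat_re, unitQuat_imI, unitQuat_imJ, unitQuat_imK, sgn]
  ring

lemma comp_sq_le (c : Fin 4) (q : ℍ[ℝ]) : comp c q ^ 2 ≤ ‖q‖ ^ 2 := by
  rw [norm_sq_quat]
  fin_cases c <;> simp [comp] <;> nlinarith [sq_nonneg q.re, sq_nonneg q.imI, sq_nonneg q.imJ,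
    sq_nonneg q.imK]

/-- Grothendieck's inequality for a quaternion matrix and its values on a finite set of
quaternions. -/
lemma quaternion_grothendieck (ht : ∀ x, unitQuat x ∈ t) (A : Fin N → Fin N → ℍ[ℝ])
    (x : Fin N → Fin k → ℍ[ℝ]) (y : Fin N → Fin k → ℝ) (hx : ∀ i, ∑ l, ‖x i l‖ ^ 2 ≤ 1)
    (hy : ∀ j, ∑ l, y j l ^ 2 ≤ 1) :
    ∃ a b : Fin N → t, ∑ l, ∑ i, ∑ j, y j l * (x i l * A i j).re ≤
      32 * ∑ i, ∑ j, (a i * A i j * b j : ℍ[ℝ]).re := by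
  have : Nonempty t := ⟨⟨_, ht 0⟩⟩
  obtain ⟨⟨a, b⟩, hab⟩ := Finite.exists_max fun ab : (Fin N → t) × (Fin N → t) =>
    ∑ i, ∑ j, (ab.1 i * A i j * ab.2 j : ℍ[ℝ]).re
  refine ⟨a, b, ?_⟩
  set M := ∑ i, ∑ j, (a i * A i j * b j : ℍ[ℝ]).re with hM
  -- Each of the four real components is a real Grothendieck problem with constant `8`, hence `32`.
  -- As `t` contains the units `±1, ±i, ±j, ±k`, its sign values are among those maximized by `M`.
  have hc : ∀ c : Fin 4, ∑ l, bilin (fun i j => (unitQuat (c, true) * A i j).re)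
      (fun i => comp c (x i l)) (y · l) ≤ 8 * M := by
    intro c
    have hx' : ∀ i, ∑ l, comp c (x i l) ^ 2 ≤ 1 := fun i =>
      (Finset.sum_le_sum fun l _ => comp_sq_le c (x i l)).trans (hx i)
    refine grothendieck (fun s s' => ?_) (fun i l => comp c (x i l)) y hx' hy
    have h := hab (fun i => ⟨unitQuat (c, s i), ht _⟩, fun j => ⟨unitQuat (0, s' j), ht _⟩)
    simp only [re_unitQuat_mul_mul] at h
    refine le_trans (le_of_eq ?_) h
    exact Finset.sum_congr rfl fun i _ => Finset.sum_congr rfl fun j _ => mul_comm _ _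
  have h1 : ∑ l, ∑ i, ∑ j, y j l * (x i l * A i j).re =
      ∑ c : Fin 4, ∑ l, bilin (fun i j => (unitQuat (c, true) * A i j).re)
        (fun i => comp c (x i l)) (y · l) := by
    rw [Finset.sum_comm (s := (Finset.univ : Finset (Fin 4)))]
    refine Finset.sum_congr rfl fun l _ => ?_
    simp only [bilin]
    rw [Finset.sum_comm (s := (Finset.univ : Finset (Fin 4)))]
    refine Finset.sum_congr rfl fun i _ => ?_
    rw [Finset.sum_comm (s := (Finset.univ : Finset (Fin 4)))]
    refine Finset.sum_congr rfl fun j _ => ?_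
    rw [re_mul_eq_sum_comp, Finset.mul_sum]
    exact Finset.sum_congr rfl fun c _ => by ring
  rw [h1]
  refine (Finset.sum_le_sum fun c _ => hc c).trans (le_of_eq ?_)
  simp
  ring

lemma sum_mul_re_le (y : Fin k → ℝ) (hy : ∑ l, y l ^ 2 ≤ 1) (Q : Fin k → ℍ[ℝ]) :
    ∑ l, y l * (Q l).re ≤ √(∑ l, ‖Q l‖ ^ 2) := by
  have h0 : 0 ≤ ∑ l, ‖Q l‖ ^ 2 := Finset.sum_nonneg fun _ _ => sq_nonneg _
  refine Real.le_sqrt_of_sq_le ?_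
  refine (Finset.sum_mul_sq_le_sq_mul_sq _ _ _).trans ?_
  refine (mul_le_of_le_one_left (Finset.sum_nonneg fun _ _ => sq_nonneg _) hy).trans ?_
  exact Finset.sum_le_sum fun l _ => sq_le_sq' (neg_le_of_abs_le (abs_re_le_norm_quat _))
    (le_of_abs_le (abs_re_le_norm_quat _))

/-- A multilinear Grothendieck inequality, with growth rate `10 √(3/2) / 9 < √2` in the order. -/
lemma multilinear_grothendieck (ht : ∀ x, unitQuat x ∈ t)
    (ht' : ∀ q : ℍ[ℝ], ∃ p ∈ t, 9 / 10 * ‖q‖ ≤ (q * p).re) (d : ℕ)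
    (A : Fin N → (Fin (d + 1) → Fin N) → ℍ[ℝ])
    (x : Fin N → Fin k → ℍ[ℝ]) (y : Fin (d + 1) → Fin N → Fin k → ℝ)
    (hx : ∀ i, ∑ l, ‖x i l‖ ^ 2 ≤ 1) (hy : ∀ j i, ∑ l, y j i l ^ 2 ≤ 1) :
    ∃ (a : Fin N → t) (b : Fin (d + 1) → Fin N → t),
      ∑ l, ∑ i, ∑ ω, (∏ j, y j (ω j) l) * (x i l * A i ω).re ≤
      32 * (√(3 / 2) * (10 / 9)) ^ d *
        ∑ i, ∑ ω, (a i * A i ω * (List.ofFn fun j => (b j (ω j) : ℍ[ℝ])).prod).re := by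
  induction d generalizing x with
  | zero =>
    obtain ⟨a, b, h⟩ := quaternion_grothendieck ht (fun i n => A i (Fin.cons n default)) x (y 0) hx
      (hy 0)
    refine ⟨a, fun _ => b, ?_⟩
    simpa [sum_fin_succ_fun] using h
  | succ d ih =>
    -- `Q l n` is the `l`-th summand with the first mode of `ω` frozen at `n` and its factor `y 0`
    -- removed.
    set Q : Fin k → Fin N → ℍ[ℝ] := fun l n =>
      ∑ i, ∑ ω : Fin (d + 1) → Fin N, (∏ j, y j.succ (ω j) l) • (x i l * A i (Fin.cons n ω)) with hQ
    have hQre : ∀ (p q : ℍ[ℝ]) l n, (p * Q l n * q).re = ∑ i, ∑ ω : Fin (d + 1) → Fin N,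
        (∏ j, y j.succ (ω j) l) * (p * (x i l * A i (Fin.cons n ω)) * q).re := by
      intro p q l n
      simp only [hQ, Finset.mul_sum, Finset.sum_mul, re_sum_quat, mul_smul_comm,
        smul_mul_assoc, Quaternion.re_smul, smul_eq_mul]
    have h1 : ∑ l, ∑ i, ∑ ω, (∏ j, y j (ω j) l) * (x i l * A i ω).re =
        ∑ n, ∑ l, y 0 n l * (Q l n).re := by
      rw [Finset.sum_comm (s := (Finset.univ : Finset (Fin N)))]
      refine Finset.sum_congr rfl fun l _ => ?_
      have : ∀ n, (Q l n).re = ∑ i, ∑ ω : Fin (d + 1) → Fin N,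
          (∏ j, y j.succ (ω j) l) * (x i l * A i (Fin.cons n ω)).re := by
        intro n
        simpa using hQre 1 1 l n
      simp only [this, sum_fin_succ_fun, Fin.prod_univ_succ (n := d + 1), Fin.cons_zero,
        Fin.cons_succ, Finset.mul_sum, mul_assoc]
      exact Finset.sum_comm
    -- Cauchy-Schwarz in `l` eliminates `y 0`, and Khinchine turns the Euclidean norm into an
    -- average of norms of single quaternions.
    have h2 : ∑ n, ∑ l, y 0 n l * (Q l n).re ≤
        √(3 / 2) * prodExp die fun ξ => ∑ n, ‖∑ l, unitQuat (ξ l) * Q l n‖ := by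
      rw [prodExp_sum, Finset.mul_sum]
      exact Finset.sum_le_sum fun n _ => (sum_mul_re_le _ (hy 0 n) _).trans (sqrt_sum_norm_sq_le _)
    obtain ⟨ξ, hξ⟩ := exists_prodExp_le die_nonneg sum_die
      fun ξ : Fin k → Fin 4 × Bool => ∑ n, ‖∑ l, unitQuat (ξ l) * Q l n‖
    choose p hp hpn using fun n => ht' (∑ l, unitQuat (ξ l) * Q l n)
    have h3 : ∑ n, ‖∑ l, unitQuat (ξ l) * Q l n‖ ≤
        10 / 9 * ∑ n, ((∑ l, unitQuat (ξ l) * Q l n) * p n).re := by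
      rw [Finset.mul_sum]
      exact Finset.sum_le_sum fun n _ => by linarith [hpn n]
    -- The units multiply `x` on the left without changing norms, while the norming elements are
    -- contracted into `A` on the right. This keeps the order of the noncommuting factors.
    obtain ⟨a, b, hab⟩ := ih (fun i ω => ∑ n, A i (Fin.cons n ω) * p n)
      (fun i l => unitQuat (ξ l) * x i l) (fun j => y j.succ)
      (fun i => by simpa [norm_unitQuat] using hx i) (fun j => hy j.succ)
    have h4 : ∑ n, ((∑ l, unitQuat (ξ l) * Q l n) * p n).re =
        ∑ l, ∑ i, ∑ ω : Fin (d + 1) → Fin N, (∏ j, y j.succ (ω j) l) *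
          (unitQuat (ξ l) * x i l * ∑ n, A i (Fin.cons n ω) * p n).re := by
      simp only [Finset.sum_mul, re_sum_quat, hQre]
      simp only [re_sum_quat, Finset.mul_sum, mul_assoc]
      rw [Finset.sum_comm]
      refine Finset.sum_congr rfl fun l _ => ?_
      rw [Finset.sum_comm]
      refine Finset.sum_congr rfl fun i _ => ?_
      rw [Finset.sum_comm]
    have h5 : ∑ i, ∑ ω : Fin (d + 1) → Fin N, (a i * (∑ n, A i (Fin.cons n ω) * p n) *
          (List.ofFn fun j => (b j (ω j) : ℍ[ℝ])).prod).re =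
        ∑ i, ∑ ω : Fin (d + 2) → Fin N, (a i * A i ω * (List.ofFn fun j =>
          ((Fin.cons (fun n => ⟨p n, hp n⟩) b : Fin (d + 2) → Fin N → t) j (ω j) : ℍ[ℝ])).prod).re
        := by
      refine Finset.sum_congr rfl fun i _ => ?_
      rw [sum_fin_succ_fun (m := d + 1), Finset.sum_comm]
      refine Finset.sum_congr rfl fun ω _ => ?_
      simp only [List.ofFn_succ (n := d + 1), List.prod_cons, Fin.cons_zero, Fin.cons_succ,
        Finset.mul_sum, Finset.sum_mul, re_sum_quat, mul_assoc]
    refine ⟨a, Fin.cons (fun n => ⟨p n, hp n⟩) b, ?_⟩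
    rw [← h5, h1]
    calc _ ≤ √(3 / 2) * (10 / 9 * ∑ n, ((∑ l, unitQuat (ξ l) * Q l n) * p n).re) :=
          h2.trans (mul_le_mul_of_nonneg_left (hξ.trans h3) (Real.sqrt_nonneg _))
      _ ≤ √(3 / 2) * (10 / 9 * (32 * (√(3 / 2) * (10 / 9)) ^ d *
          ∑ i, ∑ ω : Fin (d + 1) → Fin N, (a i * (∑ n, A i (Fin.cons n ω) * p n) *
          (List.ofFn fun j => (b j (ω j) : ℍ[ℝ])).prod).re)) := by
          rw [h4]
          exact mul_le_mul_of_nonneg_left (mul_le_mul_of_nonneg_left hab (by norm_num))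
            (Real.sqrt_nonneg _)
      _ = _ := by ring

/-- The real part of an outer product of quaternion vectors. -/
def quatProd {d : ℕ} (ab : (Fin N → t) × (Fin (d + 1) → Fin N → t)) : Tensor (d + 2) N :=
  fun ω => ((ab.1 (ω 0) : ℍ[ℝ]) * (List.ofFn fun j => (ab.2 j (ω j.succ) : ℍ[ℝ])).prod).re

lemma norm_prod_ofFn_le_one {n : ℕ} (q : Fin n → ℍ[ℝ]) (hq : ∀ j, ‖q j‖ ≤ 1) :
    ‖(List.ofFn q).prod‖ ≤ 1 := by
  induction n with
  | zero => simp
  | succ n ih =>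
    rw [List.ofFn_succ, List.prod_cons, norm_mul]
    exact mul_le_one₀ (hq 0) (norm_nonneg _) (ih _ fun j => hq _)

lemma abs_quatProd_le_one {d : ℕ} (ht1 : ∀ p ∈ t, ‖p‖ ≤ 1)
    (ab : (Fin N → t) × (Fin (d + 1) → Fin N → t)) (ω : Idx (d + 2) N) : |quatProd ab ω| ≤ 1 := by
  refine (abs_re_le_norm_quat _).trans ?_
  rw [norm_mul]
  exact mul_le_one₀ (ht1 _ (ab.1 _).2) (norm_nonneg _)
    (norm_prod_ofFn_le_one _ fun j => ht1 _ (ab.2 j _).2)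

/-- The max-qnorm ball is dominated by a finite set of quaternion rank-one tensors. -/
lemma exists_quatProd_ge {d : ℕ} (ht : ∀ x, unitQuat x ∈ t)
    (ht' : ∀ q : ℍ[ℝ], ∃ p ∈ t, 9 / 10 * ‖q‖ ≤ (q * p).re) {R : ℝ} (A X : Tensor (d + 2) N)
    (hX : maxQNorm X ≤ R) :
    ∃ ab : (Fin N → t) × (Fin (d + 1) → Fin N → t), ∑ ω, A ω * X ω ≤
      32 * (√(3 / 2) * (10 / 9)) ^ d * R * ∑ ω, A ω * quatProd ab ω := by
  have : Nonempty t := ⟨⟨_, ht 0⟩⟩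
  obtain ⟨ab, hab⟩ := Finite.exists_max fun ab : (Fin N → t) × (Fin (d + 1) → Fin N → t) =>
    ∑ ω, A ω * quatProd ab ω
  refine ⟨ab, ?_⟩
  set M := ∑ ω, A ω * quatProd ab ω with hM
  set C := 32 * (√(3 / 2) * (10 / 9)) ^ d with hC
  have hC0 : 0 < C := by positivity
  have hR : 0 ≤ R := (maxQNorm_nonneg X).trans hX
  -- Real data are embedded as central quaternions, so `A` can be moved out of the product.
  have key : ∀ (k : ℕ) (U : Fin (d + 2) → Fin N → Fin k → ℝ), (∀ j i, ∑ l, U j i l ^ 2 ≤ 1) →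
      ∑ ω, A ω * ∑ l, ∏ j, U j (ω j) l ≤ C * M := by
    intro k U hU
    obtain ⟨a, b, h⟩ := multilinear_grothendieck ht ht' d
      (fun i ω => ((A (Fin.cons i ω) : ℝ) : ℍ[ℝ])) (fun i l => ((U 0 i l : ℝ) : ℍ[ℝ]))
      (fun j => U j.succ) (fun i => by simpa using hU 0 i) (fun j => hU j.succ)
    have h2 := hab (a, b)
    refine le_trans (le_of_eq ?_) (h.trans (mul_le_mul_of_nonneg_left
      (le_trans (le_of_eq ?_) h2) hC0.le))
    · simp only [Finset.mul_sum]
      rw [Finset.sum_comm]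
      refine Finset.sum_congr rfl fun l _ => ?_
      rw [sum_fin_succ_fun]
      refine Finset.sum_congr rfl fun i _ => Finset.sum_congr rfl fun ω _ => ?_
      rw [← Quaternion.coe_mul, Quaternion.re_coe, Fin.prod_univ_succ]
      simp only [Fin.cons_zero, Fin.cons_succ]
      ring
    · rw [sum_fin_succ_fun]
      refine Finset.sum_congr rfl fun i _ => Finset.sum_congr rfl fun ω _ => ?_
      rw [← Quaternion.coe_commutes, mul_assoc, Quaternion.coe_mul_eq_smul, Quaternion.re_smul,
        smul_eq_mul]
      rfl
  have hM0 : 0 ≤ M := by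
    -- The factorization without columns makes the left side zero.
    have := key 0 (fun _ _ _ => 0) (by simp)
    simp only [Finset.univ_eq_empty, Finset.sum_empty, mul_zero, Finset.sum_const_zero] at this
    exact nonneg_of_mul_nonneg_right this hC0
  have hlt : ∀ x, R < x → ∑ ω, A ω * X ω ≤ x * (C * M) := by
    intro x hx
    obtain ⟨s, hs, hsx⟩ := exists_pow_eq (hR.trans_lt hx) (d + 1)
    obtain ⟨k, U, hU, hUs⟩ := exists_balanced_factorization hs (hsx ▸ lt_of_le_of_lt hX hx)
    have h := key k (fun j i l => U j i l / s) fun j i => by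
      simp only [div_pow, ← Finset.sum_div]
      exact div_le_one_of_le₀ (hUs j i) (sq_nonneg s)
    simp only [Finset.prod_div_distrib, Finset.prod_const, Finset.card_univ, Fintype.card_fin,
      hsx, ← Finset.sum_div, ← hU] at h
    have e : ∑ ω, A ω * (X ω / x) = (∑ ω, A ω * X ω) / x := by
      rw [Finset.sum_div]
      exact Finset.sum_congr rfl fun _ _ => by ring
    rw [e, div_le_iff₀ (hR.trans_lt hx)] at h
    linarith
  have := le_mul_of_forall_gt (by positivity) hlt
  linarith

end Tonge

/-! ### Constants and conclusion -/

section Main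

lemma isProbabilityMeasure_sampleLaw {d N m : ℕ} {f : ℝ → ℝ} {α : ℝ} {p : Idx d N → ℝ}
    {T : Tensor d N} (hf : IsLink f α) (hp : ∀ ω, 0 ≤ p ω) (hp1 : ∑ ω, p ω = 1) :
    IsProbabilityMeasure (sampleLaw m f p T) := by
  have := isProbabilityMeasure_measurementLaw (T := T) hf hp hp1
  unfold sampleLaw
  infer_instance

/-- Here `q` is the exponential factor in the order and `lam` the entropy per `d N`; `q ≥ 1` lets it
multiply the `U` term as well. -/
lemma error_le_errorRate {d N m : ℕ} {f : ℝ → ℝ} {α R δ K K₀ lam q : ℝ} (hf : IsLink f α)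
    (hα : 0 ≤ α) (hR : 0 ≤ R) (hK₀ : 0 ≤ K₀) (hlam : 0 ≤ lam) (hq : 1 ≤ q)
    (hK : K ≤ K₀ * q) :
    8 * βconst f α * (2 * Lconst f α * (K * R) * √(2 * ((d : ℝ) * N * lam) / m) +
      √8 * Uconst f α * √(Real.log (4 / δ) / m)) ≤
    8 * (2 * K₀ * √(2 * lam) + √8) * q * errorRate d N m f α R δ := by
  have hL := hf.L_nonneg hα
  have hβ := hf.β_pos hα
  have hU := hf.U_pos hα
  have e : √(2 * ((d : ℝ) * N * lam) / m) = √(2 * lam) * √((d : ℝ) * N / m) := by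
    rw [← Real.sqrt_mul (by positivity)]
    congr 1
    ring
  rw [e, errorRate]
  set X := Lconst f α * R * √((d : ℝ) * N / m) with hX
  set Y := Uconst f α * √(Real.log (4 / δ) / m) with hY
  have hX0 : 0 ≤ X := by positivity
  have hY0 : 0 ≤ Y := by positivity
  have h8 : 0 ≤ √(8 : ℝ) := Real.sqrt_nonneg _
  have hl : 0 ≤ √(2 * lam) := Real.sqrt_nonneg _
  have h1 : 2 * K * √(2 * lam) * X ≤ 2 * (K₀ * q) * √(2 * lam) * X := by gcongr
  have h2 : √8 * Y ≤ √8 * q * Y := by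
    have := mul_le_mul_of_nonneg_right hq (mul_nonneg h8 hY0)
    linarith
  have h3 : 0 ≤ 2 * K₀ * √(2 * lam) * q * Y := by positivity
  have h4 : 0 ≤ √8 * q * X := by positivity
  have h5 : 2 * K * √(2 * lam) * X + √8 * Y ≤
      (2 * K₀ * √(2 * lam) + √8) * q * (X + Y) := by linarith
  have h6 := mul_le_mul_of_nonneg_left h5 (by positivity : 0 ≤ 8 * βconst f α)
  have l1 : 8 * βconst f α * (2 * Lconst f α * (K * R) * (√(2 * lam) * √((d : ℝ) * N / m)) +
      √8 * Uconst f α * √(Real.log (4 / δ) / m)) =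
      8 * βconst f α * (2 * K * √(2 * lam) * X + √8 * Y) := by
    rw [hX, hY]
    ring
  rw [l1]
  linarith

lemma sqrt_const_le : √(3 / 2) * (10 / 9) ≤ (137 / 100 : ℝ) := by
  have : √(3 / 2) ≤ (1233 / 1000 : ℝ) := by
    rw [Real.sqrt_le_left (by norm_num)]
    norm_num
  linarith

end Main

end OneBitTensor

end

theorem mainTheorem2 :
    (∀ (d N r : ℕ) (α : ℝ) (T : OneBitTensor.Tensor d N),
      2 ≤ d → OneBitTensor.rank T ≤ r → ‖T‖ ≤ α →
        OneBitTensor.maxQNorm T ≤ OneBitTensor.radiusMax d r α ∧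
        OneBitTensor.mNorm T ≤ OneBitTensor.radiusM d r α) ∧
    ∃ Cmax c₂ CM : ℝ, 0 < Cmax ∧ 0 < c₂ ∧ c₂ < √2 ∧ 0 < CM ∧
      ∀ (d N r m : ℕ) (α : ℝ) (f : ℝ → ℝ) (p : OneBitTensor.Idx d N → ℝ)
        (T : OneBitTensor.Tensor d N),
        2 ≤ d → 2 ≤ m → m ≤ N ^ d →
        OneBitTensor.rank T ≤ r → ‖T‖ ≤ α →
        OneBitTensor.IsLink f α →
        (∀ ω, 0 ≤ p ω) → ∑ ω, p ω = 1 →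
        -- both constrained problems have a solution for every realization of the sample
        (∀ s : Fin m → OneBitTensor.Idx d N × Bool,
          (∃ X, OneBitTensor.IsEstimator f s
            (OneBitTensor.KMax d N α (OneBitTensor.radiusMax d r α)) X) ∧
          ∃ X, OneBitTensor.IsEstimator f s
            (OneBitTensor.KM d N α (OneBitTensor.radiusM d r α)) X) ∧
        ∀ δ : ℝ, 0 < δ →
          1 - δ < (OneBitTensor.sampleLaw m f p T).real {s | ∀ X,
            OneBitTensor.IsEstimator f s
              (OneBitTensor.KMax d N α (OneBitTensor.radiusMax d r α)) X →
            OneBitTensor.weightedSqError p T X ≤ Cmax * c₂ ^ d *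
              OneBitTensor.errorRate d N m f α (OneBitTensor.radiusMax d r α) δ} ∧
          1 - δ < (OneBitTensor.sampleLaw m f p T).real {s | ∀ X,
            OneBitTensor.IsEstimator f s
              (OneBitTensor.KM d N α (OneBitTensor.radiusM d r α)) X →
            OneBitTensor.weightedSqError p T X ≤ CM *
              OneBitTensor.errorRate d N m f α (OneBitTensor.radiusM d r α) δ} := by
  refine ⟨fun d N r α T hd hr hT => ?_, ?_⟩
  · obtain ⟨d, rfl⟩ := Nat.exists_eq_add_of_le' hd
    exact ⟨OneBitTensor.maxQNorm_le_radiusMax hr hT, OneBitTensor.mNorm_le_radiusM hr hT⟩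
  obtain ⟨t, ht1, ht, ht'⟩ := OneBitTensor.exists_norming_set
  -- The class has entropy `d N log |t|`; the added `1` keeps `D` positive.
  set lam : ℝ := Real.log t.card + 1 with hlam
  have hlam0 : 0 < lam := by
    have := Real.log_natCast_nonneg t.card
    linarith
  refine ⟨8 * (2 * 32 * √(2 * lam) + √8), 137 / 100, 8 * (2 * 1 * √(2 * 1) + √8), by positivity,
    by norm_num, Real.lt_sqrt_of_sq_lt (by norm_num), by positivity, ?_⟩
  intro d N r m α f p T hd hm2 hmN hr hT hf hp hp1
  have hα : 0 ≤ α := (norm_nonneg T).trans hT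
  have hm : 0 < m := by omega
  have hN : 0 < N := by
    rcases Nat.eq_zero_or_pos N with rfl | h
    · rw [zero_pow (by omega)] at hmN
      omega
    · exact h
  have : Nonempty (Fin N) := ⟨⟨0, hN⟩⟩
  have : Nonempty t := ⟨⟨_, ht 0⟩⟩
  have hN' : (0 : ℝ) < N := by exact_mod_cast hN
  obtain ⟨d, rfl⟩ := Nat.exists_eq_add_of_le' hd
  have hTmax := OneBitTensor.maxQNorm_le_radiusMax hr hT
  have hTM := OneBitTensor.mNorm_le_radiusM hr hT
  have hRmax : 0 ≤ OneBitTensor.radiusMax (d + 2) r α := mul_nonneg (Real.sqrt_nonneg _) hα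
  have hRM : 0 ≤ OneBitTensor.radiusM (d + 2) r α := mul_nonneg (by positivity) hα
  have := OneBitTensor.isProbabilityMeasure_sampleLaw (m := m) (T := T) hf hp hp1
  refine ⟨fun s => ⟨OneBitTensor.exists_isEstimator hf s (OneBitTensor.isClosed_maxQNorm_le _)
    ⟨T, hT, hTmax⟩, OneBitTensor.exists_isEstimator hf s (OneBitTensor.isClosed_mNorm_le _)
    ⟨T, hT, hTM⟩⟩, fun δ hδ => ⟨?_, ?_⟩⟩
  · refine (OneBitTensor.estimator_error hm hα hf hp hp1
      (K := OneBitTensor.KMax (d + 2) N α (OneBitTensor.radiusMax (d + 2) r α))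
      (fun X hX => hX.1) ⟨hT, hTmax⟩
      (OneBitTensor.quatProd (N := N) (t := t) (d := d))
      (OneBitTensor.abs_quatProd_le_one ht1)
      (B := 32 * (√(3 / 2) * (10 / 9)) ^ d * OneBitTensor.radiusMax (d + 2) r α)
      (D := ((d + 2 : ℕ) : ℝ) * N * lam) (by positivity) (by positivity) ?_
      (fun A X hX => OneBitTensor.exists_quatProd_ge ht ht' A X hX.2) hδ).trans_le
      (measureReal_mono fun s hs X hX => (hs X hX).trans
        (OneBitTensor.error_le_errorRate hf hα hRmax (by norm_num) hlam0.le ?_ ?_))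
    · have hcard : Fintype.card ((Fin N → t) × (Fin (d + 1) → Fin N → t)) =
          t.card ^ ((d + 2) * N) := by
        simp only [Fintype.card_prod, Fintype.card_pi, Fintype.card_coe, Finset.prod_const,
          Finset.card_univ, Fintype.card_fin, ← pow_mul, ← pow_add]
        congr 1
        ring
      rw [hcard]
      push_cast
      rw [Real.log_pow, hlam]
      push_cast
      have : (0 : ℝ) ≤ (d + 2) * N := by positivity
      linarith
    · exact one_le_pow₀ (by norm_num)
    · refine mul_le_mul_of_nonneg_left ?_ (by norm_num)
      -- The growth starts only at the third mode; since `137/100 ≥ 1`, the exponent can be raised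
      -- from `d` to `d + 2`.
      exact (pow_le_pow_left₀ (by positivity) OneBitTensor.sqrt_const_le d).trans
        (pow_le_pow_right₀ (by norm_num) (by omega))
  · refine (OneBitTensor.estimator_error hm hα hf hp hp1
      (K := OneBitTensor.KM (d + 2) N α (OneBitTensor.radiusM (d + 2) r α))
      (fun X hX => hX.1) ⟨hT, hTM⟩
      (OneBitTensor.signProd (d := d + 2) (N := N))
      (fun σ ω => (OneBitTensor.abs_signProd σ ω).le)
      (B := 1 * OneBitTensor.radiusM (d + 2) r α)
      (D := ((d + 2 : ℕ) : ℝ) * N * 1) (by positivity) (by positivity) ?_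
      (fun A X hX => by
        rw [one_mul]
        exact OneBitTensor.exists_signProd_ge A X hX.2) hδ).trans_le
      (measureReal_mono fun s hs X hX => (hs X hX).trans
        ((OneBitTensor.error_le_errorRate hf hα hRM zero_le_one zero_le_one (q := 1) le_rfl
          (by norm_num)).trans (le_of_eq (by rw [mul_one]))))
    have hcard : Fintype.card (Fin (d + 2) → Fin N → Bool) = 2 ^ ((d + 2) * N) := by
      simp only [Fintype.card_pi, Fintype.card_bool, Finset.prod_const, Finset.card_univ,
        Fintype.card_fin, ← pow_mul]
      congr 1
      ring
    rw [hcard]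
    push_cast
    rw [Real.log_pow]
    push_cast
    refine mul_le_mul_of_nonneg_left ?_ (by positivity)
    -- The entropy of the sign class is `d N log 2`, and `log 2 ≤ 1`.
    linarith [Real.log_two_lt_d9]
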